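/- All graphs are finite and simple. For an edge-colored graph $G$ (the coloring need not be proper) let $e(G)$ be its number of edges and $c(G)$ the number of colors that occur on its edges. A rainbow matching of size $k$ in $G$ is a set of $k$ pairwise vertex-disjoint edges of $G$ with pairwise distinct colors. Let $mK_2$ be the disjoint union of $m$ edges, and let $\mathrm{ex}(n,H)$ be the maximum number of edges of an $n$-vertex graph that does not contain $H$ as a subgraph. Theorem. Let $k\ge 2$ and $n\ge 12$ be integers with $n\ge 2k$. (a) Every edge-colored graph $G$ on $n$ vertices with $$e(G)+c(G)\ \ge\ \binom n2+2+\max\left\{\binom{2k-2}{2}-\binom{n-2k+2}{2},\ \mathrm{ex}\bigl(n,(k-1)K_2\bigr)\right\}$$ contains a rainbow matching of size $k$. (b) The condition is tight, for both terms of the maximum: for each of the two values $X=\binom{2k-2}{2}-\binom{n-2k+2}{2}$ and $X=\mathrm{ex}(n,(k-1)K_2)$ there is an edge-colored graph $G$ on $n$ vertices with $e(G)+c(G)=\binom n2+1+X$ that contains no rainbow matching of size $k$. In particular the bound in (a) cannot be lowered by $1$ for any such $k$ and $n$. -/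

import Mathlib

/-- The graph `m K₂`: the disjoint union of `m` copies of a single edge. -/
def matchingGraph (m : ℕ) : SimpleGraph (Fin m × Bool) where
  Adj x y := x.1 = y.1 ∧ x.2 ≠ y.2
  symm := ⟨fun _ _ h => ⟨h.1.symm, h.2.symm⟩⟩
  loopless := ⟨fun _ h => h.2 rfl⟩

namespace SimpleGraph

/-- The number `e(G)` of edges of a (finite) graph. -/
noncomputable def edgeCount {V : Type*} (G : SimpleGraph V) : ℕ :=
  G.edgeSet.ncard

/-- The number `c(G)` of colors that occur on the edges of an edge-colored (finite) graph. The
coloring is arbitrary; it need not be proper. -/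
noncomputable def colorCount {V K : Type*} {G : SimpleGraph V} (C : G.EdgeLabeling K) : ℕ :=
  (Set.range C).ncard

/-- The edge-colored graph `(G, C)` contains a rainbow matching of size `k`: a set of `k` edges
of `G`, pairwise without a common vertex, whose colors are pairwise distinct. -/
def HasRainbowMatching {V K : Type*} {G : SimpleGraph V} (C : G.EdgeLabeling K) (k : ℕ) : Prop :=
  ∃ M : Finset G.edgeSet, M.card = k ∧
    (∀ e ∈ M, ∀ f ∈ M, e ≠ f → ∀ v : V, ¬ (v ∈ e.1 ∧ v ∈ f.1)) ∧
    Set.InjOn C (M : Set G.edgeSet)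

end SimpleGraph

/-! Put K = k - 1 and d = n - 2K ≥ 2, let x be the maximum in the statement, and suppose that no
rainbow matching of size K + 1 exists. Choose one edge of each color. These edges form a graph h
inside the edge set g of G, and the hypothesis becomes |h| ≥ x + 2 + m, where m is the number of
pairs missing from g. Matchings in h are rainbow, so h has no matching of size K + 1. The main tool
is `Config.not_hasMatch_erase`: if uv is an edge of g, then h without the representative of the
color of uv has no K-matching avoiding u and v.

Tutte's theorem with d - 2 universal vertices added gives a Tutte–Berge barrier S
(`exists_barrier`). By `exists_structure`, with a = K - |S|, either h is sparse, or h lies inside a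
template: S joined to everything, a clique on a set B of 2a + 1 vertices, and a set I of d + |S| - 1
vertices with no neighbors outside S. Let δ be the number of template pairs missing from h. Counting
bounds δ + m by the size of the template minus x, while x is at least the size of a clique on 2K - 1
vertices, the size of the graph of all pairs touching K - 1 fixed vertices, and the first term of
the maximum.

Convexity in |S| (`convex_bound`) disposes of |S| ≥ 3 with a ≥ 2, up to two small cases settled by
the first term. When a ≤ 1 or |S| ≤ 2, h almost fills its template. An edge of g outside S would
then leave a K-matching of h avoiding it and its color, built from Hall's theorem and the almost
complete graphs of `hasMatch_of_card_even` and `hasMatch_of_card_odd`. The exceptional positions of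
such edges are excluded by further counting.

For tightness, a graph h is made rainbow and all other edges receive one extra color. Here h is a
clique on 2K vertices with the pairs outside it deleted from G, or an extremal graph for K K₂ inside
a complete graph G. -/

namespace RainbowMatching

open Finset

universe u

/-! ### Matchings as finite sets of pairs -/

open scoped Classical in
/-- The pairs of distinct elements of `P`. -/
noncomputable def pairs {V : Type*} (P : Finset V) : Finset (Sym2 V) :=
  P.sym2.filter fun e => ¬ e.IsDiag

/-- The pairs in `M` are pairwise disjoint. -/
def IsMatch {V : Type*} (M : Finset (Sym2 V)) : Prop :=
  ∀ e ∈ M, ∀ f ∈ M, e ≠ f → ∀ v, v ∈ e → v ∉ f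

/-- `h` contains a matching of size `k` all of whose edges lie inside `P`. -/
def HasMatch {V : Type*} (h : Finset (Sym2 V)) (P : Finset V) (k : ℕ) : Prop :=
  ∃ M ⊆ h, M ⊆ pairs P ∧ IsMatch M ∧ M.card = k

section
variable {V : Type*}

@[simp] lemma mk_mem_pairs {P : Finset V} {u v : V} : s(u, v) ∈ pairs P ↔ u ∈ P ∧ v ∈ P ∧ u ≠ v := by
  simp [pairs, and_assoc]

lemma mem_of_mem_pairs {P : Finset V} {e : Sym2 V} (he : e ∈ pairs P) {v : V} (hv : v ∈ e) :
    v ∈ P := by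
  simp only [pairs, mem_filter, mem_sym2_iff] at he
  exact he.1 v hv

lemma pairs_mono {P Q : Finset V} (hPQ : P ⊆ Q) : pairs P ⊆ pairs Q := by
  intro e
  induction e with | _ u v
  simp only [mk_mem_pairs]
  exact fun ⟨a, b, c⟩ => ⟨hPQ a, hPQ b, c⟩

lemma card_pairs (P : Finset V) : (pairs P).card = P.card.choose 2 := by
  classical
  rw [← Sym2.card_image_offDiag]
  congr 1
  ext e
  induction e with | _ u v
  simp only [mk_mem_pairs, mem_image, mem_offDiag, Prod.exists]
  constructor
  · intro h
    exact ⟨u, v, h, rfl⟩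
  · rintro ⟨a, b, h, h'⟩
    rcases Sym2.eq_iff.1 h' with ⟨rfl, rfl⟩ | ⟨rfl, rfl⟩
    · exact h
    · exact ⟨h.2.1, h.1, h.2.2.symm⟩

lemma two_mul_choose_two (m : ℕ) : 2 * (m.choose 2 : ℤ) = m * (m - 1) := by
  have h := Nat.choose_two_right m
  have h2 : 2 * m.choose 2 = m * (m - 1) := by
    rw [h]; exact Nat.mul_div_cancel' (Nat.even_mul_pred_self m).two_dvd
  rcases m with _ | m
  · simp
  · have : (2 * (m + 1).choose 2 : ℤ) = ((m + 1 : ℕ) : ℤ) * m := by exact_mod_cast h2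
    rw [this]; push_cast; ring

lemma two_mul_card_pairs (P : Finset V) : 2 * ((pairs P).card : ℤ) = P.card * (P.card - 1) := by
  rw [card_pairs, two_mul_choose_two]

lemma IsMatch.subset {M N : Finset (Sym2 V)} (hM : IsMatch M) (h : N ⊆ M) : IsMatch N :=
  fun e he f hf => hM e (h he) f (h hf)

lemma HasMatch.mono {h h' : Finset (Sym2 V)} {P P' : Finset V} {k k' : ℕ} (H : HasMatch h P k)
    (hh : h ⊆ h') (hP : P ⊆ P') (hk : k' ≤ k) : HasMatch h' P' k' := by
  obtain ⟨M, h1, h2, h3, h4⟩ := H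
  obtain ⟨N, hN, hc⟩ := exists_subset_card_eq (hk.trans h4.ge)
  exact ⟨N, hN.trans (h1.trans hh), hN.trans (h2.trans (pairs_mono hP)), h3.subset hN, hc⟩

lemma IsMatch.union [DecidableEq V] {M N : Finset (Sym2 V)} {P Q : Finset V} (hM : IsMatch M)
    (hN : IsMatch N) (hMP : M ⊆ pairs P) (hNQ : N ⊆ pairs Q) (hPQ : Disjoint P Q) :
    IsMatch (M ∪ N) := by
  intro e he f hf hef v hve hvf
  rw [disjoint_left] at hPQ
  rcases mem_union.1 he with he | he <;> rcases mem_union.1 hf with hf | hf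
  · exact hM e he f hf hef v hve hvf
  · exact hPQ (mem_of_mem_pairs (hMP he) hve) (mem_of_mem_pairs (hNQ hf) hvf)
  · exact hPQ (mem_of_mem_pairs (hMP hf) hvf) (mem_of_mem_pairs (hNQ he) hve)
  · exact hN e he f hf hef v hve hvf

lemma disjoint_pairs {P Q : Finset V} (hPQ : Disjoint P Q) : Disjoint (pairs P) (pairs Q) := by
  rw [disjoint_left] at *
  intro e
  induction e with | _ u v
  simp only [mk_mem_pairs]
  exact fun h h' => hPQ h.1 h'.1

lemma HasMatch.union [DecidableEq V] {h : Finset (Sym2 V)} {P Q : Finset V} {j k : ℕ}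
    (hP : HasMatch h P j) (hQ : HasMatch h Q k) (hPQ : Disjoint P Q) :
    HasMatch h (P ∪ Q) (j + k) := by
  obtain ⟨M, h1, h2, h3, h4⟩ := hP
  obtain ⟨N, h1', h2', h3', h4'⟩ := hQ
  refine ⟨M ∪ N, union_subset h1 h1', union_subset (h2.trans (pairs_mono subset_union_left))
    (h2'.trans (pairs_mono subset_union_right)), h3.union h3' h2 h2' hPQ, ?_⟩
  rw [card_union_of_disjoint, h4, h4']
  exact disjoint_of_subset_left h2 (disjoint_of_subset_right h2' (disjoint_pairs hPQ))

lemma isMatch_singleton (e : Sym2 V) : IsMatch {e} := by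
  intro a ha b hb hab
  simp only [mem_singleton] at ha hb
  exact absurd (ha.trans hb.symm) hab

lemma hasMatch_pair [DecidableEq V] {h : Finset (Sym2 V)} {u v : V} (huv : u ≠ v)
    (he : s(u, v) ∈ h) : HasMatch h {u, v} 1 :=
  ⟨{s(u, v)}, by simpa, by simpa, isMatch_singleton _, by simp⟩

lemma hasMatch_one {h : Finset (Sym2 V)} {P : Finset V} {e : Sym2 V} (he : e ∈ h)
    (heP : e ∈ pairs P) : HasMatch h P 1 :=
  ⟨{e}, by simpa, by simpa, isMatch_singleton _, by simp⟩

lemma card_sdiff_erase_le [DecidableEq V] (h : Finset (Sym2 V)) (f : Sym2 V) (P : Finset (Sym2 V)) :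
    (P \ h.erase f).card ≤ (P \ h).card + 1 := by
  refine (card_le_card (t := insert f (P \ h)) ?_).trans (card_insert_le _ _)
  intro e
  simp only [mem_sdiff, mem_erase, mem_insert]
  tauto

lemma card_sdiff_pair [DecidableEq V] {J : Finset V} {u v : V} (hu : u ∈ J) (hv : v ∈ J) (hne : u ≠ v) :
    (J \ {u, v}).card + 2 = J.card := by
  rw [← card_pair hne]
  apply card_sdiff_add_card_eq_card
  intro w hw
  rcases mem_insert.1 hw with rfl | hw
  · exact hu
  · rwa [mem_singleton.1 hw]

/-- The pairs with one element in `A` and one in `J`. -/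
noncomputable def cross [DecidableEq V] (A J : Finset V) : Finset (Sym2 V) :=
  (A ×ˢ J).image fun p => s(p.1, p.2)

lemma mem_cross [DecidableEq V] {A J : Finset V} {e : Sym2 V} :
    e ∈ cross A J ↔ ∃ x ∈ A, ∃ y ∈ J, s(x, y) = e := by
  simp only [cross, mem_image, mem_product, Prod.exists]
  constructor
  · rintro ⟨a, b, ⟨h1, h2⟩, h3⟩; exact ⟨a, h1, b, h2, h3⟩
  · rintro ⟨a, h1, b, h2, h3⟩; exact ⟨a, b, ⟨h1, h2⟩, h3⟩

lemma card_cross [DecidableEq V] {A J : Finset V} (h : Disjoint A J) :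
    (cross A J).card = A.card * J.card := by
  rw [cross, card_image_of_injOn, card_product]
  rintro ⟨a, b⟩ hab ⟨a', b'⟩ hab' heq
  simp only [coe_product, Set.mem_prod, mem_coe] at hab hab'
  rw [disjoint_left] at h
  rcases Sym2.eq_iff.1 heq with ⟨h1, h2⟩ | ⟨h1, h2⟩
  · simp_all
  · simp only at h1 h2
    subst h1
    exact absurd hab'.2 (h hab.1)

lemma cross_subset_pairs [DecidableEq V] {A J P : Finset V} (h : Disjoint A J) (hA : A ⊆ P)
    (hJ : J ⊆ P) : cross A J ⊆ pairs P := by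
  intro e he
  obtain ⟨x, hx, y, hy, rfl⟩ := mem_cross.1 he
  exact mk_mem_pairs.2 ⟨hA hx, hJ hy, fun e => disjoint_left.1 h hx (e ▸ hy)⟩

/-! ### Hall's theorem in deficiency form -/

/-- If there is no matching from `S` into `J` covering `S`, then Hall's condition is violated. -/
lemma exists_of_not_hasMatch [DecidableEq V] {h : Finset (Sym2 V)} {S J : Finset V}
    (hSJ : Disjoint S J) (H : ¬ HasMatch h (S ∪ J) S.card) :
    ∃ A ⊆ S, ∃ J' ⊆ J, A.Nonempty ∧ J.card + 1 ≤ J'.card + A.card ∧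
      ∀ x ∈ A, ∀ y ∈ J', s(x, y) ∉ h := by
  by_contra hcon
  push Not at hcon
  apply H
  let t : {x // x ∈ S} → Finset V := fun x => J.filter fun y => s(x.1, y) ∈ h
  have hall : ∀ A : Finset {x // x ∈ S}, A.card ≤ (A.biUnion t).card := by
    intro A
    by_contra hlt
    push Not at hlt
    -- A set violating Hall's condition, together with the part of `J` outside its neighborhood,
    -- would be the required pair.
    obtain ⟨x, hx, y, hy, hxy⟩ := hcon (A.map (Function.Embedding.subtype _)) (by
        intro x; simp; tauto) (J \ A.biUnion t) sdiff_subset (by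
        rw [map_nonempty, ← card_pos]; omega) (by
        rw [card_map]
        have : (A.biUnion t).card + (J \ A.biUnion t).card = J.card := by
          rw [add_comm]; exact card_sdiff_add_card_eq_card (by
            intro y; simp [t]; tauto)
        omega)
    simp only [mem_map, Function.Embedding.subtype_apply, Subtype.exists, exists_and_right,
      exists_eq_right] at hx
    obtain ⟨hxS, hxA⟩ := hx
    rw [mem_sdiff] at hy
    exact hy.2 (mem_biUnion.2 ⟨⟨x, hxS⟩, hxA, by simp [t, hy.1, hxy]⟩)
  obtain ⟨f, hf, hft⟩ := (Finset.all_card_le_biUnion_card_iff_exists_injective t).1 hall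
  have hf1 : ∀ x, f x ∈ J := fun x => (mem_filter.1 (hft x)).1
  have hf2 : ∀ x : {x // x ∈ S}, s(x.1, f x) ∈ h := fun x => (mem_filter.1 (hft x)).2
  rw [disjoint_left] at hSJ
  have hinj : Function.Injective fun x : {x // x ∈ S} => s(x.1, f x) := by
    intro x y hxy
    rcases Sym2.eq_iff.1 hxy with ⟨h1, _⟩ | ⟨h1, _⟩
    · exact Subtype.ext h1
    · exact absurd (hf1 y) (h1 ▸ hSJ x.2)
  refine ⟨univ.image fun x : {x // x ∈ S} => s(x.1, f x), ?_, ?_, ?_, ?_⟩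
  · intro e he
    obtain ⟨x, -, rfl⟩ := mem_image.1 he
    exact hf2 x
  · intro e he
    obtain ⟨x, -, rfl⟩ := mem_image.1 he
    exact mk_mem_pairs.2 ⟨mem_union_left _ x.2, mem_union_right _ (hf1 x), fun e =>
      hSJ x.2 (e ▸ hf1 x)⟩
  · intro e he e' he' hne v hv hv'
    obtain ⟨x, -, rfl⟩ := mem_image.1 he
    obtain ⟨y, -, rfl⟩ := mem_image.1 he'
    have hxy : x ≠ y := fun h => hne (by rw [h])
    rcases Sym2.mem_iff.1 hv with h1 | h1 <;> rcases Sym2.mem_iff.1 hv' with h2 | h2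
    · exact hxy (Subtype.ext (h1.symm.trans h2))
    · exact hSJ x.2 (h1 ▸ h2 ▸ hf1 y)
    · exact hSJ y.2 (h2 ▸ h1 ▸ hf1 x)
    · exact hxy (hf (h1.symm.trans h2))
  · rw [card_image_of_injective _ hinj]
    simp

/-! ### The Tutte–Berge barrier -/

/-- The graph with edge set `h` on `P`, joined with a complete graph on `t` new vertices. -/
def joinGraph (h : Finset (Sym2 V)) (P : Finset V) (t : ℕ) : SimpleGraph ({x // x ∈ P} ⊕ Fin t) where
  Adj x y := x ≠ y ∧ ∀ u v, x = Sum.inl u → y = Sum.inl v → s(u.1, v.1) ∈ h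
  symm := ⟨fun x y hxy => ⟨hxy.1.symm, fun u v hu hv => by
    rw [Sym2.eq_swap]; exact hxy.2 v u hv hu⟩⟩
  loopless := ⟨fun x hx => hx.1 rfl⟩

/-- At most `t` vertices of `P` are matched to new vertices, so at least 2K + 2 are matched among
themselves, by edges of `h`. -/
lemma hasMatch_of_isPerfectMatching {h : Finset (Sym2 V)} {P : Finset V} {K t : ℕ}
    (hP : 2 * K + 2 + t ≤ P.card) {M : (joinGraph h P t).Subgraph} (hM : M.IsPerfectMatching) :
    HasMatch h P (K + 1) := by
  classical
  choose p hp hp' using fun w => hM.1 (hM.2 w)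
  simp only at hp hp'
  let U : Finset {x // x ∈ P} := univ.filter fun u => ∃ v, p (Sum.inl u) = Sum.inl v
  let E : Finset (Sym2 V) := (univ.filter fun q : {x // x ∈ P} × {x // x ∈ P} =>
    M.Adj (Sum.inl q.1) (Sum.inl q.2)).image fun q => s(q.1.1, q.2.1)
  have hE : ∀ u v : {x // x ∈ P}, M.Adj (Sum.inl u) (Sum.inl v) → s(u.1, v.1) ∈ E := fun u v huv =>
    mem_image.2 ⟨(u, v), by simpa using huv, rfl⟩
  have hE' : ∀ e ∈ E, ∃ u v : {x // x ∈ P}, M.Adj (Sum.inl u) (Sum.inl v) ∧ s(u.1, v.1) = e := by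
    intro e he
    obtain ⟨⟨u, v⟩, h1, h2⟩ := mem_image.1 he
    exact ⟨u, v, by simpa using h1, h2⟩
  have huniq : ∀ u v w, M.Adj u v → M.Adj u w → v = w := fun u v w h1 h2 =>
    (hp' u v h1).trans (hp' u w h2).symm
  have hU : 2 * K + 2 ≤ U.card := by
    have h1 : (univ \ U).card ≤ t := by
      have : ∀ u ∈ univ \ U, ∃ i, p (Sum.inl u) = Sum.inr i := by
        intro u hu
        rcases hpu : p (Sum.inl u) with v | i
        · simp [U, hpu] at hu
        · exact ⟨i, rfl⟩
      have hinj : Function.Injective fun u : {x // x ∈ P} => p (Sum.inl u) := by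
        intro u v (huv : p (Sum.inl u) = p (Sum.inl v))
        have h1 := hp (Sum.inl u)
        have h2 := hp (Sum.inl v)
        rw [huv] at h1
        exact Sum.inl_injective (huniq _ _ _ h1.symm h2.symm)
      have hsub : (univ \ U).image (fun u => p (Sum.inl u)) ⊆
          (univ : Finset (Fin t)).image Sum.inr := by
        intro w hw
        obtain ⟨u, hu, rfl⟩ := mem_image.1 hw
        obtain ⟨i, hi⟩ := this u hu
        exact mem_image.2 ⟨i, mem_univ _, hi.symm⟩
      have := card_le_card hsub
      rw [card_image_of_injective _ hinj, card_image_of_injective _ Sum.inr_injective] at this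
      simpa using this
    have h2 : (univ \ U).card + U.card = P.card := by
      rw [card_sdiff_add_card_eq_card (subset_univ _)]; simp
    omega
  have hcard : U.card ≤ 2 * E.card := by
    let r : {x // x ∈ P} → Sym2 V := fun u => s(u.1, Sum.elim (fun v => v.1) (fun _ => u.1) (p (Sum.inl u)))
    have hr : ∀ u ∈ U, r u ∈ E := by
      intro u hu
      obtain ⟨v, hv⟩ := (mem_filter.1 hu).2
      have := hE u v (by have := hp (Sum.inl u); rwa [hv] at this)
      simpa [r, hv] using this
    refine card_le_mul_card_image_of_maps_to hr 2 ?_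
    intro e he
    induction e with | _ a b
    have : ((U.filter fun u => r u = s(a, b)).image Subtype.val) ⊆ {a, b} := by
      intro x hx
      obtain ⟨u, hu, rfl⟩ := mem_image.1 hx
      have h1 : u.1 ∈ r u := by simp [r]
      rw [(mem_filter.1 hu).2] at h1
      simpa using h1
    calc _ = ((U.filter fun u => r u = s(a, b)).image Subtype.val).card := by
          rw [card_image_of_injective _ Subtype.val_injective]
      _ ≤ _ := (card_le_card this).trans card_le_two
  have hmain : HasMatch h P E.card := by
    refine ⟨E, ?_, ?_, ?_, rfl⟩
    · intro e he
      obtain ⟨u, v, huv, rfl⟩ := hE' e he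
      exact (M.adj_sub huv).2 u v rfl rfl
    · intro e he
      obtain ⟨u, v, huv, rfl⟩ := hE' e he
      refine mk_mem_pairs.2 ⟨u.2, v.2, fun hne => (M.adj_sub huv).1 ?_⟩
      rw [Subtype.ext hne]
    · intro e he f hf hef x hxe hxf
      apply hef
      have key : ∀ g ∈ E, x ∈ g → ∃ u v : {x // x ∈ P}, M.Adj (Sum.inl u) (Sum.inl v) ∧
          s(u.1, v.1) = g ∧ u.1 = x := by
        intro g hg hx
        obtain ⟨u, v, huv, rfl⟩ := hE' g hg
        rcases Sym2.mem_iff.1 hx with rfl | rfl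
        · exact ⟨u, v, huv, rfl, rfl⟩
        · exact ⟨v, u, huv.symm, Sym2.eq_swap, rfl⟩
      obtain ⟨u, v, huv, rfl, hu⟩ := key e he hxe
      obtain ⟨u', v', huv', rfl, hu'⟩ := key f hf hxf
      have : u = u' := Subtype.ext (hu.trans hu'.symm)
      subst this
      rw [Sum.inl_injective (huniq _ _ _ huv huv')]
  exact hmain.mono Subset.rfl Subset.rfl (by omega)

/-- The Tutte–Berge structure: if `h` has no matching of size `K + 1` inside a set `P` of
`2 K + d` vertices, then deleting some `S ⊆ P` leaves at least `d + |S|` odd components. -/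
theorem exists_barrier {V : Type u} [DecidableEq V] {h : Finset (Sym2 V)} {P : Finset V} {K d : ℕ}
    (hd : 2 ≤ d) (hP : P.card = 2 * K + d) (H : ¬ HasMatch h P (K + 1)) :
    ∃ S ⊆ P, ∃ (ι : Type u) (_ : DecidableEq ι) (p : V → ι),
      (∀ u ∈ P \ S, ∀ v ∈ P \ S, s(u, v) ∈ h → p u = p v) ∧
      d + S.card ≤ (((P \ S).image p).filter fun c =>
        Odd ((P \ S).filter fun v => p v = c).card).card := by
  classical
  have hno : ∀ M : (joinGraph h P (d - 2)).Subgraph, ¬ M.IsPerfectMatching := fun M hM =>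
    H (hasMatch_of_isPerfectMatching (by omega) hM)
  obtain ⟨U, hU⟩ : ∃ U, (joinGraph h P (d - 2)).IsTutteViolator U := by
    by_contra hcon
    push Not at hcon
    obtain ⟨M, hM⟩ := SimpleGraph.tutte.2 hcon
    exact hno M hM
  unfold SimpleGraph.IsTutteViolator at hU
  set D := ((⊤ : (joinGraph h P (d - 2)).Subgraph).deleteVerts U) with hD
  have hverts : ∀ w, w ∈ D.verts ↔ w ∉ U := by simp [hD]
  have hadj : ∀ x y : D.verts, D.coe.Adj x y ↔ (joinGraph h P (d - 2)).Adj x y := by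
    intro x y
    have hx := (hverts _).1 x.2
    have hy := (hverts _).1 y.2
    simp [hD, hx, hy]
  have hcardW : Nat.card ({x // x ∈ P} ⊕ Fin (d - 2)) = 2 * K + d + (d - 2) := by
    simp [hP]
  have hUc : Nat.card D.verts + U.ncard = 2 * K + d + (d - 2) := by
    rw [Nat.card_coe_set_eq, ← hcardW, ← Set.ncard_add_ncard_compl U, add_comm]
    congr 2
    ext w; simp [hverts]
  have hodd := D.coe.odd_ncard_oddComponents
  -- The enlarged graph has an even number of vertices, so the number of odd components has the
  -- parity of |U|, and exceeding |U| means exceeding it by 2.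
  have hU2 : U.ncard + 2 ≤ D.coe.oddComponents.ncard := by
    rcases Nat.even_or_odd U.ncard with ⟨a, ha⟩ | ⟨a, ha⟩
    · have : ¬ Odd D.coe.oddComponents.ncard := by
        rw [hodd, Nat.not_odd_iff_even]; exact ⟨K + d - 1 - a, by omega⟩
      rw [Nat.not_odd_iff_even] at this
      obtain ⟨b, hb⟩ := this
      omega
    · have : Odd D.coe.oddComponents.ncard := by
        rw [hodd]; exact ⟨K + d - 1 - a - 1, by omega⟩
      obtain ⟨b, hb⟩ := this
      omega
  -- A new vertex outside `U` would be adjacent to everything left, leaving a single component,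
  -- while at least two are required. Hence |U| = |S| + d - 2.
  have hinr : ∀ i, Sum.inr i ∈ U := by
    intro i
    by_contra hi
    have hle : D.coe.oddComponents.ncard ≤ 1 := by
      refine (Set.ncard_le_ncard (t := {D.coe.connectedComponentMk ⟨Sum.inr i, (hverts _).2 hi⟩}) ?_
        (Set.toFinite _)).trans (by simp)
      intro c _
      induction c using SimpleGraph.ConnectedComponent.ind with | _ w
      rw [Set.mem_singleton_iff, SimpleGraph.ConnectedComponent.eq]
      by_cases hw : w = ⟨Sum.inr i, (hverts _).2 hi⟩
      · rw [hw]
      · apply SimpleGraph.Adj.reachable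
        rw [hadj]
        exact ⟨fun h' => hw (Subtype.ext h'), fun u v _ hv => by simp at hv⟩
    omega
  let S : Finset V := (P.attach.filter fun u => Sum.inl u ∈ U).image Subtype.val
  have hSP : S ⊆ P := by
    intro v hv
    obtain ⟨u, _, rfl⟩ := mem_image.1 hv
    exact u.2
  have hmemS : ∀ v (hv : v ∈ P), v ∈ S ↔ Sum.inl ⟨v, hv⟩ ∈ U := by
    intro v hv
    simp [S, hv]
  have hScard : U.ncard = S.card + (d - 2) := by
    have : U = (Sum.inl '' {u : {x // x ∈ P} | Sum.inl u ∈ U}) ∪ (Set.range Sum.inr) := by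
      ext w
      rcases w with u | i
      · simp
      · simp [hinr]
    rw [this, Set.ncard_union_eq (by
      rw [Set.disjoint_left]
      rintro _ ⟨a, _, rfl⟩ ⟨b, hb⟩
      simp at hb), Set.ncard_image_of_injective _ Sum.inl_injective]
    congr 1
    · rw [card_image_of_injective _ Subtype.val_injective, ← Set.ncard_coe_finset]
      congr 1
      ext u; simp
    · rw [← Set.image_univ, Set.ncard_image_of_injective _ Sum.inr_injective]; simp
  have hsd : ∀ v, v ∈ P \ S ↔ ∃ hv : v ∈ P, Sum.inl ⟨v, hv⟩ ∈ D.verts := by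
    intro v
    rw [mem_sdiff]
    constructor
    · rintro ⟨h1, h2⟩
      exact ⟨h1, (hverts _).2 fun h3 => h2 ((hmemS v h1).2 h3)⟩
    · rintro ⟨h1, h2⟩
      exact ⟨h1, fun h3 => (hverts _).1 h2 ((hmemS v h1).1 h3)⟩
  -- `none` is only a default for vertices outside `P \ S`.
  let p : V → Option D.coe.ConnectedComponent := fun v =>
    if hv : ∃ hv : v ∈ P, Sum.inl ⟨v, hv⟩ ∈ D.verts then
      some (D.coe.connectedComponentMk ⟨Sum.inl ⟨v, hv.1⟩, hv.2⟩) else none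
  have hpv : ∀ v (hv : v ∈ P) (hv' : Sum.inl ⟨v, hv⟩ ∈ D.verts),
      p v = some (D.coe.connectedComponentMk ⟨Sum.inl ⟨v, hv⟩, hv'⟩) := by
    intro v hv hv'
    simp only [p]
    rw [dif_pos ⟨hv, hv'⟩]
  refine ⟨S, hSP, _, inferInstance, p, ?_, ?_⟩
  · intro u hu v hv huv
    obtain ⟨hu1, hu2⟩ := (hsd u).1 hu
    obtain ⟨hv1, hv2⟩ := (hsd v).1 hv
    rw [hpv u hu1 hu2, hpv v hv1 hv2]
    by_cases hne : u = v
    · subst hne; rfl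
    · congr 1
      rw [SimpleGraph.ConnectedComponent.eq]
      apply SimpleGraph.Adj.reachable
      rw [hadj]
      refine ⟨by simpa using hne, ?_⟩
      rintro a b ha hb
      rw [← Sum.inl_injective ha, ← Sum.inl_injective hb]
      exact huv
  · have hsupp : ∀ c : D.coe.ConnectedComponent,
        ((P \ S).filter fun v => p v = some c).card = c.supp.ncard := by
      intro c
      rw [← Set.ncard_coe_finset]
      refine Set.ncard_congr (fun v hv => ⟨Sum.inl ⟨v, ((hsd v).1 (mem_filter.1 hv).1).1⟩,
        ((hsd v).1 (mem_filter.1 hv).1).2⟩) ?_ ?_ ?_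
      · intro v hv
        have h1 := (mem_filter.1 hv).2
        rw [hpv v ((hsd v).1 (mem_filter.1 hv).1).1 ((hsd v).1 (mem_filter.1 hv).1).2] at h1
        exact Option.some_injective _ h1
      · intro u v hu hv huv
        simpa using huv
      · rintro ⟨w, hw⟩ hwc
        rcases w with ⟨v, hv⟩ | i
        · have hv' := (hsd v).2 ⟨hv, hw⟩
          refine ⟨v, ?_, rfl⟩
          rw [mem_coe, mem_filter]
          refine ⟨hv', ?_⟩
          rw [hpv v hv hw]
          exact congrArg some hwc
        · exact absurd (hinr i) ((hverts _).1 hw)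
    have hle : D.coe.oddComponents.ncard ≤ (((P \ S).image p).filter fun c =>
        Odd ((P \ S).filter fun v => p v = c).card).card := by
      rw [← Set.ncard_coe_finset, ← Set.ncard_image_of_injective _ (Option.some_injective _)]
      apply Set.ncard_le_ncard _ (Set.toFinite _)
      rintro _ ⟨c, hc, rfl⟩
      rw [mem_coe, mem_filter]
      have hc' : Odd ((P \ S).filter fun v => p v = some c).card := by rw [hsupp]; exact hc
      refine ⟨?_, hc'⟩
      obtain ⟨v, hv⟩ := card_pos.1 hc'.pos
      exact mem_image.2 ⟨v, (mem_filter.1 hv).1, (mem_filter.1 hv).2⟩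
    omega

end

/-! ### Structure and size of graphs without a large matching -/

section
variable {V : Type u}

lemma sum_mul_pred_le {ι : Type*} (C : Finset ι) (e : ι → ℤ) (he : ∀ i ∈ C, 0 ≤ e i) :
    ∑ i ∈ C, (e i + 1) * e i ≤ (∑ i ∈ C, e i + 1) * ∑ i ∈ C, e i := by
  classical
  induction C using Finset.induction_on with
  | empty => simp
  | insert i C hi ih =>
    rw [sum_insert hi, sum_insert hi]
    have h1 := ih fun j hj => he j (mem_insert_of_mem hj)
    have h2 := he i (mem_insert_self _ _)
    have h3 : 0 ≤ ∑ j ∈ C, e j := sum_nonneg fun j hj => he j (mem_insert_of_mem hj)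
    nlinarith

lemma two_mul_card_inter_pairs_le [DecidableEq V] {ι : Type*} [DecidableEq ι]
    {h : Finset (Sym2 V)} {R : Finset V} {p : V → ι}
    (hp : ∀ u ∈ R, ∀ v ∈ R, s(u, v) ∈ h → p u = p v) :
    2 * ((h ∩ pairs R).card : ℤ) ≤ ∑ i ∈ R.image p,
      ((R.filter fun v => p v = i).card : ℤ) * ((R.filter fun v => p v = i).card - 1) := by
  have hsub : h ∩ pairs R ⊆ (R.image p).biUnion fun i => pairs (R.filter fun v => p v = i) := by
    intro e
    induction e with | _ u v
    simp only [mem_inter, mk_mem_pairs, mem_biUnion, mem_filter, mem_image]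
    rintro ⟨h1, h2, h3, h4⟩
    exact ⟨p u, ⟨u, h2, rfl⟩, ⟨h2, rfl⟩, ⟨h3, (hp u h2 v h3 h1).symm⟩, h4⟩
  have h1 := (card_le_card hsub).trans card_biUnion_le
  have h2 : ((h ∩ pairs R).card : ℤ) ≤
      ∑ i ∈ R.image p, ((pairs (R.filter fun v => p v = i)).card : ℤ) := by exact_mod_cast h1
  calc _ ≤ 2 * ∑ i ∈ R.image p, ((pairs (R.filter fun v => p v = i)).card : ℤ) := by linarith
    _ = _ := by
      rw [mul_sum]
      exact sum_congr rfl fun i _ => two_mul_card_pairs _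

/-- For component orders `c i`, the sum over `C.erase i₀` is the excess of the other components over
singletons. The first bound gathers this excess into one component; the second replaces a factor `c
i` by the largest order. -/
lemma sum_mul_pred_le_of_max {ι : Type*} [DecidableEq ι] (C : Finset ι) (c : ι → ℕ) {i₀ : ι}
    (hi₀ : i₀ ∈ C) (hpos : ∀ i ∈ C, 1 ≤ c i) (hmax : ∀ i ∈ C, c i ≤ c i₀) :
    ∑ i ∈ C, (c i : ℤ) * (c i - 1) ≤ c i₀ * (c i₀ - 1) +
      (((∑ i ∈ C.erase i₀, (c i - 1) : ℕ) : ℤ) + 1) * ((∑ i ∈ C.erase i₀, (c i - 1) : ℕ) : ℤ) ∧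
    ∑ i ∈ C, (c i : ℤ) * (c i - 1) ≤
      c i₀ * (c i₀ - 1 + ((∑ i ∈ C.erase i₀, (c i - 1) : ℕ) : ℤ)) := by
  have hcast : ∑ i ∈ C.erase i₀, ((c i : ℤ) - 1) = ((∑ i ∈ C.erase i₀, (c i - 1) : ℕ) : ℤ) := by
    push_cast
    exact sum_congr rfl fun i hi => by
      have := hpos i (mem_of_mem_erase hi)
      omega
  constructor
  · rw [← add_sum_erase _ _ hi₀]
    have := sum_mul_pred_le (C.erase i₀) (fun i => (c i : ℤ) - 1) fun i hi => by
      have := hpos i (mem_of_mem_erase hi)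
      omega
    simp only [sub_add_cancel] at this
    rw [hcast] at this
    linarith
  · calc _ ≤ ∑ i ∈ C, (c i₀ : ℤ) * (c i - 1) := by
          refine sum_le_sum fun i hi => ?_
          have h1 : (c i : ℤ) ≤ c i₀ := by exact_mod_cast hmax i hi
          have h2 : (1 : ℤ) ≤ c i := by exact_mod_cast hpos i hi
          nlinarith
      _ = _ := by
        rw [← mul_sum, ← add_sum_erase _ _ hi₀, hcast]

/-- Here `b` is the largest component order and `r` the excess of the others. For b ≤ a, `hB` gives
2E ≤ 2a². For b > a, the bound `hA` with r = 2a + 1 - b is convex in b and its critical end is b =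
2a - 2, r = 3, the source of the 12. The 6 in the weaker bound is what b = 2a - 1, r = 2 gives. -/
lemma class_bound {a b r E : ℤ} (hr : 0 ≤ r) (hrb : r ≤ 2 * a + 1 - b) (hb : 2 ≤ b)
    (hba : b + 2 ≤ 2 * a) (hA : 2 * E ≤ b * (b - 1) + (r + 1) * r)
    (hB : 2 * E ≤ b * (b - 1 + r)) :
    2 * E ≤ (2 * a - 1) * (2 * a - 2) + 6 ∧ 2 * E ≤ (2 * a - 2) * (2 * a - 3) + 12 := by
  rcases le_or_gt b a with h | h
  · have : b * (b - 1 + r) ≤ a * (2 * a) := by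
      apply mul_le_mul <;> linarith
    constructor <;> nlinarith [sq_nonneg (a - 2), sq_nonneg (a - 3)]
  · have h1 : (r + 1) * r ≤ (2 * a + 2 - b) * (2 * a + 1 - b) := by
      apply mul_le_mul <;> linarith
    have h2 : 0 ≤ (b - a - 1) * (2 * a - 2 - b) := by
      apply mul_nonneg <;> linarith
    constructor <;> nlinarith

lemma class_bound_top {a b r E : ℤ} (hr : 0 ≤ r) (hrb : r ≤ 2 * a + 1 - b) (hb : b = 2 * a - 1)
    (hA : 2 * E ≤ b * (b - 1) + (r + 1) * r) : 2 * E ≤ (2 * a - 1) * (2 * a - 2) + 6 := by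
  subst hb
  nlinarith

/-- The structure of an edge set without a matching of size `K + 1`: after deleting a set `S`,
either only the pairs inside a single set `B` of size `2 a + 1` can be present, where
`|S| + a = K`, or there are few edges. -/
theorem exists_structure [DecidableEq V] {h : Finset (Sym2 V)} {P : Finset V} {K d : ℕ}
    (hd : 2 ≤ d) (hP : P.card = 2 * K + d) (H : ¬ HasMatch h P (K + 1)) :
    ∃ S ⊆ P, ∃ a, S.card + a = K ∧
      ((∃ B I, B ∪ I = P \ S ∧ Disjoint B I ∧ B.card = 2 * a + 1 ∧ I.card + 1 = d + S.card ∧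
        ∀ u ∈ I, ∀ v ∈ P \ S, u ≠ v → s(u, v) ∉ h) ∨
      (2 ≤ a ∧ 2 * ((h ∩ pairs (P \ S)).card : ℤ) ≤ (2 * a - 1) * (2 * a - 2) + 6 ∧
        (2 * ((h ∩ pairs (P \ S)).card : ℤ) ≤ (2 * a - 2) * (2 * a - 3) + 12 ∨
        ∃ J ⊆ P \ S, d + S.card ≤ J.card + 3 ∧ ∀ u ∈ J, ∀ v ∈ P \ S, u ≠ v → s(u, v) ∉ h))) := by
  obtain ⟨S, hS, ι, _, p, hp, hodd⟩ := exists_barrier hd hP H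
  set R := P \ S with hR
  set C := R.image p with hC
  set c : ι → ℕ := fun i => (R.filter fun v => p v = i).card with hc
  have hRcard : R.card + S.card = P.card := card_sdiff_add_card_eq_card hS
  have hcpos : ∀ i ∈ C, 1 ≤ c i := by
    intro i hi
    obtain ⟨v, hv, rfl⟩ := mem_image.1 hi
    exact card_pos.2 ⟨v, mem_filter.2 ⟨hv, rfl⟩⟩
  have hsum : ∑ i ∈ C, c i = R.card := (card_eq_sum_card_image p R).symm
  have hq : (C.filter fun i => Odd (c i)).card ≤ C.card := card_filter_le _ _
  have hqR : C.card ≤ R.card := card_image_le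
  change d + S.card ≤ (C.filter fun i => Odd (c i)).card at hodd
  have hSK : S.card ≤ K := by omega
  refine ⟨S, hS, K - S.card, by omega, ?_⟩
  obtain ⟨a, ha⟩ : ∃ a, S.card + a = K := ⟨K - S.card, by omega⟩
  have haK : K - S.card = a := by omega
  rw [haK]
  have hR2 : R.card = 2 * a + (d + S.card) := by omega
  have hCne : C.Nonempty := card_pos.1 (by omega)
  obtain ⟨i₀, hi₀, hmax⟩ := exists_max_image C c hCne
  have hisol : ∀ u ∈ R, c (p u) = 1 → ∀ v ∈ R, u ≠ v → s(u, v) ∉ h := by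
    intro u hu hcu v hv huv hh
    obtain ⟨w, hw⟩ := card_eq_one.1 hcu
    have h1 : u ∈ R.filter fun v => p v = p u := mem_filter.2 ⟨hu, rfl⟩
    have h2 : v ∈ R.filter fun v => p v = p u := mem_filter.2 ⟨hv, (hp u hu v hv hh).symm⟩
    rw [hw, mem_singleton] at h1 h2
    exact huv (h1.trans h2.symm)
  have hsum2 : ∑ i ∈ C.erase i₀, c i + c i₀ = R.card := by rw [sum_erase_add _ _ hi₀, hsum]
  have hsplit : ∑ i ∈ C.erase i₀, (c i - 1) + (C.card - 1) = ∑ i ∈ C.erase i₀, c i := by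
    rw [← card_erase_of_mem hi₀, card_eq_sum_ones, ← sum_add_distrib]
    exact sum_congr rfl fun i hi => Nat.sub_add_cancel (hcpos i (mem_of_mem_erase hi))
  -- Since `R` has 2a + d + |S| vertices and at least d + |S| components, `c i₀ + r` is at most 2a +
  -- 1.
  set r := ∑ i ∈ C.erase i₀, (c i - 1) with hr
  have hb1 := hcpos i₀ hi₀
  have hCpos : 1 ≤ C.card := by omega
  by_cases hr0 : r = 0
  · left
    have hone : ∀ i ∈ C, i ≠ i₀ → c i = 1 := by
      intro i hi hne
      have := (sum_eq_zero_iff.1 hr0) i (mem_erase.2 ⟨hne, hi⟩)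
      have := hcpos i hi
      omega
    have hW : (R.filter fun v => ¬ p v = i₀).card + c i₀ = R.card := by
      rw [add_comm]; exact card_filter_add_card_filter_not _
    -- All components but the largest are singletons. Exactly d + |S| - 1 of them go into `I`; any
    -- surplus stays in `B`, which fixes |B| = 2a + 1.
    obtain ⟨I, hI, hIc⟩ := exists_subset_card_eq
      (show d + S.card - 1 ≤ (R.filter fun v => ¬ p v = i₀).card by omega)
    have hIR : I ⊆ R := hI.trans (filter_subset _ _)
    refine ⟨R \ I, I, sdiff_union_of_subset hIR, sdiff_disjoint, ?_, by omega, ?_⟩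
    · rw [card_sdiff_of_subset hIR]; omega
    · intro u hu
      have hu' := mem_filter.1 (hI hu)
      exact hisol u hu'.1 (hone _ (mem_image_of_mem _ hu'.1) hu'.2)
  · right
    have hb2 : 2 ≤ c i₀ := by
      by_contra hlt
      apply hr0
      refine sum_eq_zero fun i hi => ?_
      have := hmax i (mem_of_mem_erase hi)
      omega
    -- As r ≥ 1, the order is at most 2a. Equality would leave exactly d + |S| components, all of
    -- them odd, contradicting that 2a is even.
    have hb3 : c i₀ + 1 ≤ 2 * a := by
      rcases Nat.lt_or_ge (c i₀) (2 * a) with hlt | hge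
      · exact hlt
      · exfalso
        have : C.card = d + S.card := by omega
        have hall : C.filter (fun i => Odd (c i)) = C :=
          eq_of_subset_of_card_le (filter_subset _ _) (by omega)
        have ho : Odd (c i₀) := by
          rw [← hall] at hi₀; exact (mem_filter.1 hi₀).2
        obtain ⟨t, ht⟩ := ho
        omega
    have ha2 : 2 ≤ a := by omega
    refine ⟨ha2, ?_⟩
    have hE := two_mul_card_inter_pairs_le hp
    change _ ≤ ∑ i ∈ C, (c i : ℤ) * (c i - 1) at hE
    obtain ⟨hA, hB⟩ := sum_mul_pred_le_of_max C c hi₀ hcpos hmax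
    rw [← hr] at hA hB
    have hrb : (r : ℤ) ≤ 2 * a + 1 - c i₀ := by omega
    have hb2' : (2 : ℤ) ≤ c i₀ := by exact_mod_cast hb2
    have hr' : (0 : ℤ) ≤ r := by positivity
    rcases Nat.lt_or_ge (c i₀ + 1) (2 * a) with hlt | hge
    · have := class_bound hr' hrb hb2' (by omega) (hE.trans hA) (hE.trans hB)
      exact ⟨this.1, Or.inl this.2⟩
    -- Now the largest order is 2a - 1 and r ≤ 2, so at most two other components are not
    -- singletons. At least d + |S| - 3 singletons remain.
    · refine ⟨class_bound_top hr' hrb (by omega) (hE.trans hA), Or.inr ⟨R.filter fun v => c (p v) = 1,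
        filter_subset _ _, ?_, fun u hu => hisol u (mem_filter.1 hu).1 (mem_filter.1 hu).2⟩⟩
      have h1 : (C.filter fun i => c i = 1).card ≤ (R.filter fun v => c (p v) = 1).card := by
        refine (card_le_card ?_).trans (card_image_le (f := p))
        intro i hi
        obtain ⟨hi1, hi2⟩ := mem_filter.1 hi
        obtain ⟨v, hv, rfl⟩ := mem_image.1 hi1
        exact mem_image_of_mem _ (mem_filter.2 ⟨hv, hi2⟩)
      have h2 : (C.filter fun i => ¬ c i = 1).card ≤ 1 + r := by
        have : (C.filter fun i => ¬ c i = 1) ⊆ insert i₀ ((C.erase i₀).filter fun i => ¬ c i = 1) := by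
          intro i hi
          obtain ⟨hi1, hi2⟩ := mem_filter.1 hi
          by_cases h : i = i₀
          · simp [h]
          · simp [h, hi1, hi2]
        refine (card_le_card this).trans ((card_insert_le _ _).trans ?_)
        have : ((C.erase i₀).filter fun i => ¬ c i = 1).card ≤ r := by
          rw [card_eq_sum_ones, hr]
          refine (sum_le_sum fun i hi => ?_).trans
            (sum_le_sum_of_subset (filter_subset (fun i => ¬ c i = 1) (C.erase i₀)))
          have := hcpos i (mem_of_mem_erase (mem_filter.1 hi).1)
          have := (mem_filter.1 hi).2
          omega
        omega
      have h3 : (C.filter fun i => c i = 1).card + (C.filter fun i => ¬ c i = 1).card = C.card :=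
        card_filter_add_card_filter_not _
      omega

/-- Upper bound on the number of edges touching a set. -/
lemma two_mul_card_inter_pairs_le_of_sdiff [DecidableEq V] (h : Finset (Sym2 V)) {P S : Finset V}
    (hS : S ⊆ P) : 2 * ((h ∩ pairs P).card : ℤ) ≤
      S.card * (2 * P.card - S.card - 1) + 2 * ((h ∩ pairs (P \ S)).card : ℤ) := by
  have h1 : (h ∩ pairs P).card ≤ (pairs P \ pairs (P \ S)).card + (h ∩ pairs (P \ S)).card := by
    refine (card_le_card ?_).trans (card_union_le _ _)
    intro e
    simp only [mem_inter, mem_union, mem_sdiff]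
    tauto
  have h2 : (pairs P \ pairs (P \ S)).card + (pairs (P \ S)).card = (pairs P).card :=
    card_sdiff_add_card_eq_card (pairs_mono sdiff_subset)
  have h3 := two_mul_card_pairs P
  have h4 := two_mul_card_pairs (P \ S)
  have h5 : (P \ S).card + S.card = P.card := card_sdiff_add_card_eq_card hS
  have h6 : ((P \ S).card : ℤ) = P.card - S.card := by omega
  rw [h6] at h4
  have h1' : ((h ∩ pairs P).card : ℤ) ≤ (pairs P \ pairs (P \ S)).card + (h ∩ pairs (P \ S)).card := by
    exact_mod_cast h1
  have h2' : ((pairs P \ pairs (P \ S)).card : ℤ) + (pairs (P \ S)).card = (pairs P).card := by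
    exact_mod_cast h2
  nlinarith

lemma inter_pairs_subset_of_structure [DecidableEq V] {h : Finset (Sym2 V)} {R B I : Finset V}
    (hBI : B ∪ I = R) (hI : ∀ u ∈ I, ∀ v ∈ R, u ≠ v → s(u, v) ∉ h) :
    h ∩ pairs R ⊆ pairs B := by
  intro e
  induction e with | _ u v
  simp only [mem_inter, mk_mem_pairs]
  rintro ⟨h1, h2, h3, h4⟩
  have hu : u ∉ I := fun hu => hI u hu v h3 h4 h1
  have hv : v ∉ I := fun hv => hI v hv u h2 h4.symm (by rwa [Sym2.eq_swap])
  rw [← hBI, mem_union] at h2 h3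
  exact ⟨h2.resolve_right hu, h3.resolve_right hv, h4⟩

/-- The Erdős–Gallai bound. -/
theorem exists_card_le_of_not_hasMatch [DecidableEq V] {h : Finset (Sym2 V)} {P : Finset V}
    {K d : ℕ} (hd : 2 ≤ d) (hP : P.card = 2 * K + d) (H : ¬ HasMatch h P (K + 1)) :
    ∃ s a : ℕ, s + a = K ∧ 2 * ((h ∩ pairs P).card : ℤ) ≤
      s * (2 * P.card - s - 1) + (2 * a + 1) * (2 * a) := by
  obtain ⟨S, hS, a, ha, hh⟩ := exists_structure hd hP H
  refine ⟨S.card, a, ha, (two_mul_card_inter_pairs_le_of_sdiff h hS).trans ?_⟩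
  suffices 2 * ((h ∩ pairs (P \ S)).card : ℤ) ≤ (2 * a + 1) * (2 * a) by linarith
  rcases hh with ⟨B, I, h1, -, h3, -, h5⟩ | ⟨h1, h2, -⟩
  · have h6 := card_le_card (inter_pairs_subset_of_structure h1 h5)
    have h7 := two_mul_card_pairs B
    rw [h3] at h7
    push_cast at h7
    have : ((h ∩ pairs (P \ S)).card : ℤ) ≤ (pairs B).card := by exact_mod_cast h6
    nlinarith
  · have : (2 : ℤ) ≤ a := by exact_mod_cast h1
    nlinarith

lemma card_inter_add_card_sdiff_pairs [DecidableEq V] (h : Finset (Sym2 V)) (P : Finset V) :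
    (h ∩ pairs P).card + (pairs P \ h).card = (pairs P).card := by
  rw [inter_comm]; exact card_inter_add_card_sdiff _ _

/-! ### Matchings in almost complete graphs -/

/-- An almost complete graph on `2 N` vertices has a perfect matching. -/
theorem hasMatch_of_card_even [DecidableEq V] {h : Finset (Sym2 V)} {P : Finset V} {N : ℕ}
    (hP : P.card = 2 * N) (hmis : (pairs P \ h).card + 1 < 2 * N) : HasMatch h P N := by
  rcases N with _ | K
  · omega
  by_contra H
  obtain ⟨s, a, hsa, hE⟩ := exists_card_le_of_not_hasMatch le_rfl (by omega) H
  have h1 := card_inter_add_card_sdiff_pairs h P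
  have h2 := two_mul_card_pairs P
  rw [hP] at h2 hE
  have h3 : ((h ∩ pairs P).card : ℤ) + (pairs P \ h).card = (pairs P).card := by exact_mod_cast h1
  have h4 : ((pairs P \ h).card : ℤ) + 1 < 2 * (K + 1) := by exact_mod_cast hmis
  subst hsa
  push_cast at *
  have hs : (0 : ℤ) ≤ s := by positivity
  have ha : (0 : ℤ) ≤ a := by positivity
  have hsa : (0 : ℤ) ≤ s * a := by positivity
  rcases Nat.eq_zero_or_pos s with h0 | h0
  · subst h0; push_cast at *; nlinarith
  · have : (1 : ℤ) ≤ s := by exact_mod_cast h0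
    nlinarith

/-- An almost complete graph on `2 a + 1` vertices has a matching of size `a`. -/
theorem hasMatch_of_card_odd [DecidableEq V] {h : Finset (Sym2 V)} {P : Finset V} {a : ℕ}
    (hP : P.card = 2 * a + 1) (hmis : (pairs P \ h).card + 2 < 4 * a) : HasMatch h P a := by
  rcases a with _ | K
  · omega
  by_contra H
  obtain ⟨s, a, hsa, hE⟩ := exists_card_le_of_not_hasMatch (d := 3) (by norm_num) (by omega) H
  have h1 := card_inter_add_card_sdiff_pairs h P
  have h2 := two_mul_card_pairs P
  rw [hP] at h2 hE
  have h3 : ((h ∩ pairs P).card : ℤ) + (pairs P \ h).card = (pairs P).card := by exact_mod_cast h1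
  have h4 : ((pairs P \ h).card : ℤ) + 2 < 4 * (K + 1) := by exact_mod_cast hmis
  subst hsa
  push_cast at *
  have hs : (0 : ℤ) ≤ s := by positivity
  have ha : (0 : ℤ) ≤ a := by positivity
  have hsa : (0 : ℤ) ≤ s * a := by positivity
  -- Integrality is used: a product of two consecutive integers is never negative.
  have hss : (0 : ℤ) ≤ ((s : ℤ) - 1) * (s - 2) := by
    rcases Nat.lt_or_ge s 2 with h0 | h0
    · interval_cases s <;> simp
    · have : (2 : ℤ) ≤ s := by exact_mod_cast h0
      apply mul_nonneg <;> linarith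
  nlinarith

/-- If an almost complete graph on `2 K` vertices has no perfect matching, then it has an
isolated vertex. -/
lemma exists_isolated_of_not_hasMatch [DecidableEq V] {h : Finset (Sym2 V)} {P : Finset V} {K : ℕ} (hK : 4 ≤ K)
    (hP : P.card = 2 * K) (hmis : (pairs P \ h).card + 7 ≤ 4 * K) (H : ¬ HasMatch h P K) :
    ∃ z ∈ P, ∀ w ∈ P, z ≠ w → s(z, w) ∉ h := by
  obtain ⟨K, rfl⟩ : ∃ K', K = K' + 1 := ⟨K - 1, by omega⟩
  obtain ⟨S, hS, a, ha, hstr⟩ := exists_structure le_rfl (by omega) H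
  have h1 := two_mul_card_inter_pairs_le_of_sdiff h hS
  have h2 := card_inter_add_card_sdiff_pairs h P
  have h3 := two_mul_card_pairs P
  rw [hP] at h1 h3
  zify at h2 hmis ha hK
  push_cast at h1 h3
  have hs : (0 : ℤ) ≤ S.card := by positivity
  have ha0 : (0 : ℤ) ≤ a := by positivity
  have haK : (K : ℤ) = S.card + a := by omega
  rw [haK] at h1 h3 hmis hK
  rcases hstr with ⟨B, I, h4, -, h6, h7, h8⟩ | ⟨h4, h5, -⟩
  · have h9 := card_le_card (inter_pairs_subset_of_structure h4 h8)
    have h10 := two_mul_card_pairs B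
    rw [h6] at h10
    push_cast at h10
    zify at h9
    rcases Nat.eq_zero_or_pos S.card with hS0 | hS0
    · rw [card_eq_zero] at hS0
      subst hS0
      rw [sdiff_empty] at h4 h8
      obtain ⟨z, hz⟩ := card_pos.1 (show 0 < I.card by omega)
      exact ⟨z, h4 ▸ mem_union_right _ hz, h8 z hz⟩
    · exfalso
      have hS1 : (1 : ℤ) ≤ S.card := by exact_mod_cast hS0
      have hsa : 0 ≤ ((S.card : ℤ) - 1) * a := by apply mul_nonneg <;> linarith
      have hss : 0 ≤ ((S.card : ℤ) - 2) * (S.card - 3) := by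
        rcases le_or_gt (S.card : ℤ) 2 with h | h
        · apply mul_nonneg_of_nonpos_of_nonpos <;> linarith
        · apply mul_nonneg <;> omega
      linarith
  · exfalso
    have : (2 : ℤ) ≤ a := by exact_mod_cast h4
    nlinarith [mul_nonneg hs ha0]

end

/-! ### The hypothetical counterexample -/

section
variable {V : Type u} [Fintype V] [DecidableEq V]

/-- A graph with edge set `g` on `2 K + d` vertices without a rainbow matching of size `K + 1`,
together with a system `h` of representatives of its colors, where `φ` maps each edge to the
representative of its color, and such that `h` has more edges than the theorem allows. -/
structure Config (K d : ℕ) (x : ℤ) (h g : Finset (Sym2 V)) (φ : Sym2 V → Sym2 V) : Prop where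
  one_le : 1 ≤ K
  two_le : 2 ≤ d
  twelve_le : 12 ≤ 2 * K + d
  card_univ : (univ : Finset V).card = 2 * K + d
  subset : h ⊆ g
  subset_pairs : g ⊆ pairs univ
  map_mem : ∀ e ∈ g, φ e ∈ h
  map_self : ∀ e ∈ h, φ e = e
  not_rainbow : ∀ M ⊆ g, IsMatch M → M.card = K + 1 → ¬ Set.InjOn φ M
  card_le : ∀ h' ⊆ h, ¬ HasMatch h' univ K → (h'.card : ℤ) ≤ x
  le_card : x + 2 + (pairs univ \ g).card ≤ h.card
  clique_le : (K - 1 : ℤ) * (2 * K - 1) ≤ x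
  star_le : (K - 1 : ℤ) * (3 * K + 2 * d) ≤ 2 * x
  first_le : 2 * (K : ℤ) * (2 * K - 1) - d * (d - 1) ≤ 2 * x

variable {K d : ℕ} {x : ℤ} {h g : Finset (Sym2 V)} {φ : Sym2 V → Sym2 V}

namespace Config

lemma not_hasMatch_univ (c : Config K d x h g φ) : ¬ HasMatch h univ (K + 1) := by
  rintro ⟨M, h1, -, h3, h4⟩
  refine c.not_rainbow M (h1.trans c.subset) h3 h4 ?_
  intro e he f hf hef
  rwa [c.map_self e (h1 he), c.map_self f (h1 hf)] at hef

/-- Adding uv to such a matching would give a rainbow matching of size K + 1: edges of `h` have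
distinct colors, and the color of uv has been removed. -/
lemma not_hasMatch_erase (c : Config K d x h g φ) {u v : V} (huv : s(u, v) ∈ g) {Q : Finset V}
    (hu : u ∉ Q) (hv : v ∉ Q) : ¬ HasMatch (h.erase (φ s(u, v))) Q K := by
  rintro ⟨M, h1, h2, h3, h4⟩
  have hMh : M ⊆ h := h1.trans (erase_subset _ _)
  have hne : s(u, v) ∉ M := fun hm => hu (mem_of_mem_pairs (h2 hm) (Sym2.mem_mk_left _ _))
  have huvne : u ≠ v := (mk_mem_pairs.1 (c.subset_pairs huv)).2.2
  refine c.not_rainbow (insert s(u, v) M) ?_ ?_ (by rw [card_insert_of_notMem hne, h4]) ?_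
  · exact insert_subset huv (hMh.trans c.subset)
  · rw [← singleton_union]
    refine (isMatch_singleton _).union (P := {u, v}) h3 (by simpa) h2 ?_
    simp [hu, hv]
  · have hne' : ∀ e ∈ M, φ e ≠ φ s(u, v) := by
      intro e he
      rw [c.map_self e (hMh he)]
      exact ne_of_mem_erase (h1 he)
    intro e he f hf hef
    rcases mem_insert.1 (mem_coe.1 he) with rfl | he <;>
      rcases mem_insert.1 (mem_coe.1 hf) with rfl | hf
    · rfl
    · exact absurd hef.symm (hne' f hf)
    · exact absurd hef (hne' e he)
    · rwa [c.map_self e (hMh he), c.map_self f (hMh hf)] at hef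

/-- Two edges of `g` with different colors extend a matching of `h` that avoids their colors. -/
lemma false_of_two_edges (c : Config K d x h g φ) {u v u' v' : V} (huv : s(u, v) ∈ g)
    (huv' : s(u', v') ∈ g) (hdisj : Disjoint ({u, v} : Finset V) {u', v'})
    (hφ : φ s(u, v) ≠ φ s(u', v')) {Q : Finset V} (hQ : Disjoint ({u, v} ∪ {u', v'}) Q)
    (hf : φ s(u, v) ∉ pairs Q) (hf' : φ s(u', v') ∉ pairs Q) {j : ℕ} (hj : j + 1 = K)
    (H : HasMatch h Q j) : False := by
  obtain ⟨M, h1, h2, h3, h4⟩ := H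
  have huvne : u ≠ v := (mk_mem_pairs.1 (c.subset_pairs huv)).2.2
  have huvne' : u' ≠ v' := (mk_mem_pairs.1 (c.subset_pairs huv')).2.2
  have hN : ({s(u, v)} ∪ {s(u', v')} : Finset (Sym2 V)) ⊆ pairs ({u, v} ∪ {u', v'}) := by
    intro e he
    rcases mem_union.1 he with he | he <;> rw [mem_singleton.1 he] <;> simp [huvne, huvne']
  have hNM : IsMatch ({s(u, v)} ∪ {s(u', v')}) :=
    (isMatch_singleton _).union (P := {u, v}) (Q := {u', v'}) (isMatch_singleton _)
      (by simpa) (by simpa) hdisj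
  have hne0 : s(u, v) ≠ s(u', v') := fun e => hφ (by rw [e])
  refine c.not_rainbow ({s(u, v)} ∪ {s(u', v')} ∪ M) ?_ (hNM.union h3 hN h2 hQ) ?_ ?_
  · refine union_subset (union_subset ?_ ?_) (h1.trans c.subset) <;> simpa
  · rw [card_union_of_disjoint, h4, card_union_of_disjoint (by simpa using hne0)]
    · simp; omega
    · exact disjoint_of_subset_left hN (disjoint_of_subset_right h2 (disjoint_pairs hQ))
  · have hM : ∀ e ∈ M, φ e = e := fun e he => c.map_self e (h1 he)
    have h5 : ∀ e ∈ M, φ e ≠ φ s(u, v) := fun e he heq => hf (heq ▸ (hM e he).symm ▸ h2 he)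
    have h6 : ∀ e ∈ M, φ e ≠ φ s(u', v') := fun e he heq => hf' (heq ▸ (hM e he).symm ▸ h2 he)
    intro e he f hf hef
    simp only [coe_union, coe_singleton, Set.union_singleton, Set.mem_union, Set.mem_insert_iff,
      Set.mem_singleton_iff, mem_coe] at he hf
    rcases he with (rfl | rfl) | he <;> rcases hf with (rfl | rfl) | hf
    · rfl
    · exact absurd hef.symm hφ
    · exact absurd hef.symm (h6 f hf)
    · exact absurd hef hφ
    · rfl
    · exact absurd hef.symm (h5 f hf)
    · exact absurd hef (h6 e he)
    · exact absurd hef (h5 e he)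
    · rwa [hM e he, hM f hf] at hef

/-- Removing one representative leaves more than `x` edges, hence a K-matching. It misses the
isolated vertices u and v, so an edge uv of `g` would extend it. -/
lemma notMem_of_isolated (c : Config K d x h g φ) {u v : V} (hu : ∀ w, u ≠ w → s(u, w) ∉ h)
    (hv : ∀ w, v ≠ w → s(v, w) ∉ h) : s(u, v) ∉ g := by
  intro huv
  have hlt : x < ((h.erase (φ s(u, v))).card : ℤ) := by
    have h1 := card_erase_of_mem (c.map_mem _ huv)
    have h2 := c.le_card
    have h3 : (0 : ℤ) ≤ (pairs univ \ g).card := by positivity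
    omega
  have H : HasMatch (h.erase (φ s(u, v))) univ K := by
    by_contra H
    exact absurd (c.card_le _ (erase_subset _ _) H) (not_le.2 hlt)
  obtain ⟨M, h1, h2, h3, h4⟩ := H
  refine c.not_hasMatch_erase huv (Q := univ \ {u, v}) (by simp) (by simp) ⟨M, h1, ?_, h3, h4⟩
  intro e he
  have he1 := h2 he
  have he2 := mem_of_mem_erase (h1 he)
  induction e with | _ p q
  have hpq := (mk_mem_pairs.1 he1).2.2
  simp only [mk_mem_pairs, mem_sdiff, mem_univ, mem_insert, mem_singleton, true_and]
  refine ⟨?_, ?_, hpq⟩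
  · rintro (rfl | rfl)
    · exact hu _ hpq he2
    · exact hv _ hpq he2
  · rw [Sym2.eq_swap] at he2
    rintro (rfl | rfl)
    · exact hu _ hpq.symm he2
    · exact hv _ hpq.symm he2

lemma card_pairs_le_of_disjoint {J : Finset V} (hJ : ∀ u ∈ J, ∀ v ∈ J, s(u, v) ∉ g) :
    (J.card : ℤ) * (J.card - 1) ≤ 2 * (pairs univ \ g).card := by
  rw [← two_mul_card_pairs]
  have : pairs J ⊆ pairs univ \ g := by
    intro e
    induction e with | _ u v
    intro he
    rw [mem_sdiff]
    rw [mk_mem_pairs] at he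
    exact ⟨by simp [he.2.2], hJ u he.1 v he.2.1⟩
  exact_mod_cast Nat.mul_le_mul_left 2 (card_le_card this)

lemma card_isolated_le (c : Config K d x h g φ) {J : Finset V}
    (hJ : ∀ u ∈ J, ∀ w, u ≠ w → s(u, w) ∉ h) :
    (J.card : ℤ) * (J.card - 1) ≤ 2 * (pairs univ \ g).card :=
  card_pairs_le_of_disjoint fun u hu v hv => c.notMem_of_isolated (hJ u hu) (hJ v hv)

end Config

/-! ### The template given by `S`, `B` and `I` -/

/-- `S`, `B`, `I` partition the vertices and the edges of `h` all touch `S` or lie inside `B`. -/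
structure Big (h : Finset (Sym2 V)) (d a : ℕ) (S B I : Finset V) : Prop where
  union : B ∪ I = univ \ S
  disj : Disjoint B I
  card_B : B.card = 2 * a + 1
  card_I : I.card + 1 = d + S.card
  notMem : ∀ u ∈ I, ∀ v ∈ univ \ S, u ≠ v → s(u, v) ∉ h

/-- The pairs that touch `S` or lie inside `B` and do not belong to `h`. -/
noncomputable def missing (h : Finset (Sym2 V)) (S B : Finset V) : Finset (Sym2 V) :=
  (pairs univ \ h) \ (pairs (univ \ S) \ pairs B)

lemma mem_missing {S B : Finset V} {u v : V} : s(u, v) ∈ missing h S B ↔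
    u ≠ v ∧ s(u, v) ∉ h ∧ (u ∈ S ∨ v ∈ S ∨ (u ∈ B ∧ v ∈ B)) := by
  simp only [missing, mem_sdiff, mk_mem_pairs, mem_univ, true_and]
  tauto

namespace Big

variable {a : ℕ} {S B I : Finset V}

lemma notMem_B_of_S (b : Big h d a S B I) {v : V} (hv : v ∈ S) : v ∉ B := fun hB => by
  have : v ∈ univ \ S := b.union ▸ mem_union_left _ hB
  exact (mem_sdiff.1 this).2 hv

lemma notMem_I_of_S (b : Big h d a S B I) {v : V} (hv : v ∈ S) : v ∉ I := fun hB => by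
  have : v ∈ univ \ S := b.union ▸ mem_union_right _ hB
  exact (mem_sdiff.1 this).2 hv

lemma notMem_I_of_B (b : Big h d a S B I) {v : V} (hv : v ∈ B) : v ∉ I :=
  disjoint_left.1 b.disj hv

lemma notMem_S_of_I (b : Big h d a S B I) {v : V} (hv : v ∈ I) : v ∉ S :=
  fun hS => b.notMem_I_of_S hS hv

lemma notMem_B_of_I (b : Big h d a S B I) {v : V} (hv : v ∈ I) : v ∉ B :=
  fun hB => b.notMem_I_of_B hB hv

lemma isolated (b : Big h d a S B I) {y : V} (hy : y ∈ I) (hS : ∀ x ∈ S, s(x, y) ∉ h) :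
    ∀ w, y ≠ w → s(y, w) ∉ h := by
  intro w hw
  by_cases hwS : w ∈ S
  · rw [Sym2.eq_swap]; exact hS w hwS
  · exact b.notMem y hy w (by simp [hwS]) hw

lemma count (b : Big h d a S B I) (hh : h ⊆ pairs univ) :
    2 * (h.card : ℤ) + 2 * (missing h S B).card =
      S.card * (2 * (univ : Finset V).card - S.card - 1) + (2 * a + 1) * (2 * a) := by
  have hB : B ⊆ univ \ S := b.union ▸ subset_union_left
  have h1 : (missing h S B).card + (pairs (univ \ S) \ pairs B).card = (pairs univ \ h).card := by
    apply card_sdiff_add_card_eq_card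
    intro e he
    rw [mem_sdiff] at he ⊢
    refine ⟨pairs_mono (subset_univ _) he.1, fun hh => he.2 ?_⟩
    exact inter_pairs_subset_of_structure b.union b.notMem (mem_inter.2 ⟨hh, he.1⟩)
  have h2 : (pairs univ \ h).card + h.card = (pairs (univ : Finset V)).card :=
    card_sdiff_add_card_eq_card hh
  have h3 : (pairs (univ \ S) \ pairs B).card + (pairs B).card = (pairs (univ \ S)).card :=
    card_sdiff_add_card_eq_card (pairs_mono hB)
  have h4 := two_mul_card_pairs (univ : Finset V)
  have h5 := two_mul_card_pairs (univ \ S)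
  have h6 := two_mul_card_pairs B
  have h7 : (univ \ S).card + S.card = (univ : Finset V).card :=
    card_sdiff_add_card_eq_card (subset_univ S)
  have h8 : ((univ \ S).card : ℤ) = (univ : Finset V).card - S.card := by omega
  rw [b.card_B] at h6
  rw [h8] at h5
  push_cast at h6
  zify at h1 h2 h3
  linarith

lemma sdiff_subset_missing {P : Finset V} (hP : P ⊆ S ∪ B) :
    pairs P \ h ⊆ missing h S B := by
  intro e
  induction e with | _ u v
  rw [mem_sdiff, mk_mem_pairs, mem_missing]
  rintro ⟨⟨h1, h2, h3⟩, h4⟩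
  have h1 := mem_union.1 (hP h1)
  have h2 := mem_union.1 (hP h2)
  tauto

lemma card_sdiff_le {P : Finset V} (hP : P ⊆ S ∪ B) (f : Sym2 V) :
    (pairs P \ h.erase f).card ≤ (missing h S B).card + 1 :=
  (card_sdiff_erase_le h f _).trans (Nat.add_le_add_right
    (card_le_card (sdiff_subset_missing hP)) 1)

lemma cross_subset_missing {A J : Finset V} (hA : A ⊆ S) (hJ : Disjoint S J)
    (hn : ∀ x ∈ A, ∀ y ∈ J, s(x, y) ∉ h) : cross A J ⊆ missing h S B := by
  intro e he
  obtain ⟨x, hx, y, hy, rfl⟩ := mem_cross.1 he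
  rw [mem_missing]
  exact ⟨fun e => disjoint_left.1 hJ (hA hx) (e ▸ hy), hn x hx y hy, Or.inl (hA hx)⟩

/-- If no edge of `h` other than `f` joins `A` and `J`, then almost all pairs are missing. -/
lemma card_mul_le {A J : Finset V} (hA : A ⊆ S) (hJ : Disjoint S J) {f : Sym2 V}
    (hn : ∀ x ∈ A, ∀ y ∈ J, s(x, y) ∉ h.erase f) :
    A.card * J.card ≤ (missing h S B).card + 1 := by
  rw [← card_cross (disjoint_of_subset_left hA hJ)]
  refine (card_le_card (t := insert f (missing h S B)) ?_).trans (card_insert_le _ _)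
  intro e he
  obtain ⟨x, hx, y, hy, rfl⟩ := mem_cross.1 he
  rw [mem_insert, mem_missing]
  by_cases hf : s(x, y) = f
  · exact Or.inl hf
  · exact Or.inr ⟨fun e => disjoint_left.1 hJ (hA hx) (e ▸ hy),
      fun hh => hn x hx y hy (mem_erase.2 ⟨hf, hh⟩), Or.inl (hA hx)⟩

end Big

variable {a : ℕ} {S B I : Finset V}

lemma exists_pair_of_lt (J : Finset V)
    (hJ : 2 * ((pairs univ \ g).card : ℤ) < J.card * (J.card - 1)) :
    ∃ u ∈ J, ∃ v ∈ J, s(u, v) ∈ g := by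
  by_contra hcon
  push Not at hcon
  exact absurd (Config.card_pairs_le_of_disjoint hcon) (not_le.2 hJ)

/-! ### The cases a = 0 and a = 1 -/

namespace Config

lemma ne_of_mem (c : Config K d x h g φ) {u v : V} (huv : s(u, v) ∈ g) : u ≠ v :=
  (mk_mem_pairs.1 (c.subset_pairs huv)).2.2

lemma count (c : Config K d x h g φ) (b : Big h d a S B I) :
    2 * (h.card : ℤ) + 2 * (missing h S B).card =
      S.card * (2 * (2 * K + d) - S.card - 1) + (2 * a + 1) * (2 * a) := by
  have := b.count (c.subset.trans c.subset_pairs)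
  rw [c.card_univ] at this
  push_cast at this
  exact this

lemma five_le (c : Config K d x h g φ) (hd : d = 2) : 5 ≤ K := by
  have := c.twelve_le
  omega

/-- If d = 2, then n ≥ 12 forces K ≥ 5, and the first term of the maximum, about 2K², exceeds the
template, which has about 3K²/2 pairs. -/
lemma three_le_of_le_one (c : Config K d x h g φ) (b : Big h d a S B I) (hS : S.card + a = K)
    (ha : a ≤ 1) : 3 ≤ d := by
  by_contra hd
  have hd2 : d = 2 := by have := c.two_le; omega
  have hK := c.five_le hd2
  have h1 := c.count b
  have h2 := c.le_card
  have h3 := c.first_le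
  subst hd2
  have hS' : (S.card : ℤ) = K - a := by omega
  have hm : (0 : ℤ) ≤ (pairs univ \ g).card := by positivity
  have hδ : (0 : ℤ) ≤ (missing h S B).card := by positivity
  have hK' : (5 : ℤ) ≤ K := by exact_mod_cast hK
  rw [hS'] at h1
  interval_cases a <;> push_cast at * <;> nlinarith

/-- If a pair outside `S` lies in `g`, then some vertex of `S` has few neighbors outside `S`. -/
lemma exists_few_neighbors (c : Config K d x h g φ) (b : Big h d 0 S B I) (hS : S.card = K)
    (hd : 3 ≤ d) {u v : V} (huv : s(u, v) ∈ g) (hu : u ∉ S) (hv : v ∉ S) :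
    ∃ y ∈ S, (((univ \ S).filter fun w => s(y, w) ∈ h) \ {u, v}).card ≤ 1 := by
  have hne := c.ne_of_mem huv
  have hJ : (univ \ S).card = K + d := by
    have h1 := card_sdiff_add_card_eq_card (subset_univ S)
    have h2 := c.card_univ
    omega
  set Q := (univ \ S) \ {u, v} with hQ
  have hQc : Q.card + 2 = K + d := by
    rw [← hJ]
    exact card_sdiff_pair (by simp [hu]) (by simp [hv]) hne
  have hSQ : Disjoint S Q :=
    disjoint_of_subset_right sdiff_subset disjoint_sdiff
  have H := c.not_hasMatch_erase huv (Q := S ∪ Q) (by simp [hQ, hu]) (by simp [hQ, hv])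
  rw [← hS] at H
  obtain ⟨A, hAS, J', hJ', hA, hcard, hno⟩ := exists_of_not_hasMatch hSQ H
  have hmul := Big.card_mul_le (B := B) hAS (disjoint_of_subset_right hJ' hSQ) hno
  have hAK := card_le_card hAS
  have hApos := card_pos.2 hA
  have h1 := c.count b
  have h2 := c.le_card
  have h3 := c.star_le
  have hm : (0 : ℤ) ≤ (pairs univ \ g).card := by positivity
  -- A Hall violator with at least two vertices would make more pairs missing than the count allows.
  have hA1 : A.card = 1 := by
    by_contra hA1
    have hA2 : (2 : ℤ) ≤ A.card := by omega
    have hmul' : (A.card : ℤ) * J'.card ≤ (missing h S B).card + 1 := by exact_mod_cast hmul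
    have hJ'' : (K : ℤ) + d - 1 - A.card ≤ J'.card := by omega
    have hAK' : (A.card : ℤ) ≤ K := by omega
    have hd' : (3 : ℤ) ≤ d := by exact_mod_cast hd
    have hKd : (7 : ℤ) ≤ K + d := by have := c.twelve_le; omega
    rw [hS] at h1
    push_cast at h1
    have h5 : (A.card : ℤ) * (K + d - 1 - A.card) ≤ A.card * J'.card :=
      mul_le_mul_of_nonneg_left hJ'' (by positivity)
    have h6 : 0 ≤ ((A.card : ℤ) - 2) * (K - A.card) := by
      apply mul_nonneg <;> linarith
    have h7 : 0 ≤ ((A.card : ℤ) - 2) * (d - 3) := by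
      apply mul_nonneg <;> linarith
    nlinarith
  obtain ⟨y, hy⟩ := card_eq_one.1 hA1
  have hyA : y ∈ A := by rw [hy]; simp
  refine ⟨y, hAS hyA, ?_⟩
  -- With |A| = 1 the deficiency forces all of `Q`: the only possible edge of `h` from `y` into `Q`
  -- is the representative of the color of uv.
  have hJQ : J' = Q := eq_of_subset_of_card_le hJ' (by omega)
  rw [card_le_one]
  intro p hp q hq
  simp only [mem_sdiff, mem_filter, mem_univ, true_and, mem_insert, mem_singleton] at hp hq
  have key : ∀ w, w ∉ S → s(y, w) ∈ h → ¬ (w = u ∨ w = v) → s(y, w) = φ s(u, v) := by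
    intro w hw1 hw2 hw3
    by_contra hne
    refine hno y hyA w ?_ (mem_erase.2 ⟨hne, hw2⟩)
    rw [hJQ]
    simp [hQ, hw1, hw3]
  have h8 := key p hp.1.1 hp.1.2 hp.2
  rw [← key q hq.1.1 hq.1.2 hq.2] at h8
  exact Sym2.congr_right.1 h8

/-- Each edge of `g` outside `S` yields a vertex of `S` with at most three neighbors outside `S`.
One such vertex nearly exhausts the allowance for δ + m; a second edge is chosen so that it must
yield a different one. -/
lemma false_of_card_eq (c : Config K d x h g φ) (b : Big h d 0 S B I) (hS : S.card = K) :
    False := by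
  have hd := c.three_le_of_le_one b hS (by norm_num)
  have hJ : (univ \ S).card = K + d := by
    have h1 := card_sdiff_add_card_eq_card (subset_univ S)
    have h2 := c.card_univ
    omega
  have h1 := c.count b
  have h2 := c.le_card
  have h3 := c.star_le
  have hKd : 7 ≤ K + d := by have := c.twelve_le; omega
  set m := (pairs univ \ g).card
  set δ := (missing h S B).card with hδ
  have hδm : δ + m + 2 ≤ K + d := by
    zify
    rw [hS] at h1
    push_cast at h1
    nlinarith
  have hfew : ∀ y ∈ S, ∀ u v, (((univ \ S).filter fun w => s(y, w) ∈ h) \ {u, v}).card ≤ 1 →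
      ((univ \ S).filter fun w => s(y, w) ∈ h).card ≤ 3 := by
    intro y _ u v hy
    have h4 := card_le_card_sdiff_add_card (s := ((univ \ S).filter fun w => s(y, w) ∈ h))
      (t := {u, v})
    have h5 := card_le_two (a := u) (b := v)
    omega
  have hmiss : ∀ y ∈ S, cross {y} ((univ \ S).filter fun w => s(y, w) ∉ h) ⊆ missing h S B := by
    intro y hy
    apply Big.cross_subset_missing (by simpa using hy)
    · exact disjoint_of_subset_right (filter_subset _ _) disjoint_sdiff
    · intro z hz w hw
      rw [mem_singleton.1 hz]
      exact (mem_filter.1 hw).2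
  have hmissc : ∀ y ∈ S, (cross {y} ((univ \ S).filter fun w => s(y, w) ∉ h)).card +
      ((univ \ S).filter fun w => s(y, w) ∈ h).card = K + d := by
    intro y hy
    rw [card_cross, card_singleton, one_mul, ← hJ, add_comm]
    · exact card_filter_add_card_filter_not _
    · simp [hy]
  obtain ⟨u, hu, v, hv, huv⟩ : ∃ u ∈ univ \ S, ∃ v ∈ univ \ S, s(u, v) ∈ g := by
    apply exists_pair_of_lt
    rw [hJ]
    push_cast
    have : (m : ℤ) + 2 ≤ K + d := by omega
    have : (7 : ℤ) ≤ K + d := by omega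
    nlinarith
  obtain ⟨y, hyS, hy⟩ := c.exists_few_neighbors b hS hd huv (by simpa using hu) (by simpa using hv)
  have hy3 := hfew y hyS u v hy
  have hyc := hmissc y hyS
  have hyδ := card_le_card (hmiss y hyS)
  set N := (univ \ S).filter fun w => s(y, w) ∈ h with hN
  have hN2 : 2 ≤ N.card := by omega
  -- At most one pair is now missing from `g`, and at least four vertices outside `S` avoid `N`, u
  -- and v, so they span an edge of `g`.
  obtain ⟨u', hu', v', hv', huv'⟩ : ∃ u' ∈ (univ \ S) \ ((N \ {u, v}) ∪ {u, v}),
      ∃ v' ∈ (univ \ S) \ ((N \ {u, v}) ∪ {u, v}), s(u', v') ∈ g := by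
    apply exists_pair_of_lt
    have h4 : 4 ≤ ((univ \ S) \ ((N \ {u, v}) ∪ {u, v})).card := by
      have h5 := le_card_sdiff ((N \ {u, v}) ∪ {u, v}) (univ \ S)
      have h6 := card_union_le (N \ {u, v}) {u, v}
      have h7 := card_le_two (a := u) (b := v)
      omega
    have h5 : (m : ℤ) ≤ 1 := by omega
    have h6 : (4 : ℤ) ≤ ((univ \ S) \ ((N \ {u, v}) ∪ {u, v})).card := by exact_mod_cast h4
    nlinarith
  rw [sdiff_union_self_eq_union] at hu' hv'
  simp only [mem_sdiff, mem_univ, true_and, mem_union, not_or] at hu' hv'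
  obtain ⟨z, hzS, hz⟩ := c.exists_few_neighbors b hS hd huv' hu'.1 hv'.1
  by_cases hzy : z = y
  · subst hzy
    have : N \ {u', v'} = N := by
      rw [_root_.sdiff_eq_self_iff_disjoint, disjoint_comm, disjoint_left]
      intro w hw hw'
      rcases mem_insert.1 hw' with rfl | hw'
      · exact hu'.2.1 hw
      · rw [mem_singleton.1 hw'] at hw
        exact hv'.2.1 hw
    rw [← hN, this] at hz
    omega
  · have hz3 := hfew z hzS u' v' hz
    have hzc := hmissc z hzS
    have hdis : Disjoint (cross {y} ((univ \ S).filter fun w => s(y, w) ∉ h))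
        (cross {z} ((univ \ S).filter fun w => s(z, w) ∉ h)) := by
      rw [disjoint_left]
      intro e he he'
      obtain ⟨p, hp, q, hq, rfl⟩ := mem_cross.1 he
      obtain ⟨p', hp', q', hq', heq⟩ := mem_cross.1 he'
      rw [mem_singleton] at hp hp'
      subst hp hp'
      rcases Sym2.eq_iff.1 heq with ⟨h4, _⟩ | ⟨h4, _⟩
      · exact hzy h4
      · subst h4
        exact (mem_sdiff.1 (mem_filter.1 hq).1).2 hzS
    have h4 := card_le_card (union_subset (hmiss y hyS) (hmiss z hzS))
    rw [card_union_of_disjoint hdis] at h4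
    omega

/-- Here δ + m ≤ 1. For an edge uv of `g` inside `I`, the triangle `B` keeps an edge of a different
color and Hall's theorem matches `S` into the rest of `I`: K edges avoiding u, v and the color of
uv. -/
lemma false_of_card_add_one_eq (c : Config K d x h g φ) (b : Big h d 1 S B I)
    (hS : S.card + 1 = K) : False := by
  have hd := c.three_le_of_le_one b hS le_rfl
  have h1 := c.count b
  have h2 := c.le_card
  have h3 := c.star_le
  have hKd : 7 ≤ K + d := by have := c.twelve_le; omega
  have hI : I.card + 2 = K + d := by have := b.card_I; omega
  set m := (pairs univ \ g).card
  set δ := (missing h S B).card with hδ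
  have hδm : δ + m ≤ 1 := by
    zify
    have hS' : (S.card : ℤ) = K - 1 := by omega
    rw [hS'] at h1
    push_cast at h1
    nlinarith
  obtain ⟨u, hu, v, hv, huv⟩ : ∃ u ∈ I, ∃ v ∈ I, s(u, v) ∈ g := by
    apply exists_pair_of_lt
    have : (m : ℤ) ≤ 1 := by omega
    have : (5 : ℤ) ≤ I.card := by omega
    nlinarith
  have hne := c.ne_of_mem huv
  set Q := I \ {u, v} with hQ
  have hQc : Q.card + 2 = I.card := card_sdiff_pair hu hv hne
  have hSI : Disjoint S I := disjoint_left.2 fun w hw => b.notMem_I_of_S hw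
  have hSQ : Disjoint S Q := disjoint_of_subset_right sdiff_subset hSI
  have hBm : HasMatch (h.erase (φ s(u, v))) B 1 := by
    have h4 := Big.card_sdiff_le (h := h) (S := S) (B := B) subset_union_right (φ s(u, v))
    have h5 : (pairs B).card = 3 := by rw [card_pairs, b.card_B]; rfl
    have h6 := card_inter_add_card_sdiff_pairs (h.erase (φ s(u, v))) B
    obtain ⟨e, he⟩ : (h.erase (φ s(u, v)) ∩ pairs B).Nonempty := card_pos.1 (by omega)
    exact hasMatch_one (mem_inter.1 he).1 (mem_inter.1 he).2
  have hSm : HasMatch (h.erase (φ s(u, v))) (S ∪ Q) S.card := by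
    by_contra H
    obtain ⟨A, hAS, J', hJ', hA, hcard, hno⟩ := exists_of_not_hasMatch hSQ H
    have hmul := Big.card_mul_le (B := B) hAS (disjoint_of_subset_right hJ' hSQ) hno
    have hAK := card_le_card hAS
    have hApos := card_pos.2 hA
    have h6 : A.card * J'.card ≤ 2 := by omega
    have h7 : A.card ≤ 2 := by nlinarith
    interval_cases A.card <;> omega
  refine c.not_hasMatch_erase huv (Q := S ∪ Q ∪ B) ?_ ?_ ((hSm.union hBm ?_).mono Subset.rfl
    Subset.rfl (by omega))
  · simp [hQ, b.notMem_S_of_I hu, b.notMem_B_of_I hu]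
  · simp [hQ, b.notMem_S_of_I hv, b.notMem_B_of_I hv]
  · rw [disjoint_left]
    intro w hw hwB
    rcases mem_union.1 hw with hw | hw
    · exact b.notMem_B_of_S hw hwB
    · exact b.notMem_I_of_B hwB (mem_sdiff.1 hw).1

end Config

/-! ### The case |S| = 2 -/

lemma card_mul_pred_mono {p q : ℕ} {r m : ℤ} (hq : (q : ℤ) * (q - 1) ≤ m) (hpq : p ≤ q)
    (hr : r = p) : r * (r - 1) ≤ m := by
  subst hr
  rcases Nat.eq_zero_or_pos p with rfl | hp
  · refine le_trans ?_ hq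
    rcases Nat.eq_zero_or_pos q with rfl | hq0
    · simp
    · have : (1 : ℤ) ≤ q := by exact_mod_cast hq0
      push_cast
      nlinarith
  · have h1 : (1 : ℤ) ≤ p := by exact_mod_cast hp
    have h2 : (p : ℤ) ≤ q := by exact_mod_cast hpq
    nlinarith

lemma numeric_two {K d m : ℤ} (hK : 4 ≤ K) (hd : 3 ≤ d) (hm : m ≤ 3)
    (h1 : (d - 2) * (d - 2 - 1) ≤ 2 * m) (h2 : 4 * K + 2 * m ≤ d ^ 2 - d + 8)
    (h3 : 2 * d * K - 2 * d + 2 * m ≤ K ^ 2 - 3 * K + 8) : False := by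
  have hd5 : d ≤ 5 := by
    by_contra hd5
    have : 6 ≤ d := by omega
    nlinarith
  have hK7 : K ≤ 7 := by nlinarith
  interval_cases d <;> interval_cases K <;> omega

namespace Config

/-- If no edge of `h` except possibly `f` joins `S` and `J ⊆ I`, then all but at most one of
the vertices of `J` are isolated in `h`. -/
lemma card_isolated_le_of_no_edge (c : Config K d x h g φ) (b : Big h d a S B I) {J : Finset V}
    (hJ : J ⊆ I) {f : Sym2 V} (hno : ∀ y ∈ S, ∀ w ∈ J, s(y, w) ∉ h.erase f) {q : ℤ}
    (hq : q + 1 = J.card) (hq0 : 0 ≤ q) : q * (q - 1) ≤ 2 * (pairs univ \ g).card := by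
  have hT : (J.filter fun w => ¬ ∀ y ∈ S, s(y, w) ∉ h).card ≤ 1 := by
    rw [card_le_one]
    intro p hp q hq
    obtain ⟨hpJ, hp⟩ := mem_filter.1 hp
    obtain ⟨hqJ, hq⟩ := mem_filter.1 hq
    push Not at hp hq
    obtain ⟨y, hy, hyp⟩ := hp
    obtain ⟨z, hz, hzq⟩ := hq
    have h1 : s(y, p) = f := by
      by_contra hne
      exact hno y hy p hpJ (mem_erase.2 ⟨hne, hyp⟩)
    have h2 : s(z, q) = f := by
      by_contra hne
      exact hno z hz q hqJ (mem_erase.2 ⟨hne, hzq⟩)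
    rcases Sym2.eq_iff.1 (h1.trans h2.symm) with ⟨_, h3⟩ | ⟨h3, _⟩
    · exact h3
    · exact absurd (hJ hqJ) (h3 ▸ b.notMem_I_of_S hy)
  have hc : (J.filter fun w => ∀ y ∈ S, s(y, w) ∉ h).card +
      (J.filter fun w => ¬ ∀ y ∈ S, s(y, w) ∉ h).card = J.card :=
    card_filter_add_card_filter_not _
  have hiso := c.card_isolated_le (J := J.filter fun w => ∀ y ∈ S, s(y, w) ∉ h)
    fun u hu => b.isolated (hJ (mem_filter.1 hu).1) (mem_filter.1 hu).2
  exact card_mul_pred_mono (p := q.toNat) hiso (by omega) (by omega)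

/-- If `I` is independent in `g`, then m is too large. Otherwise take an edge uv of `g` in `I`. An
edge yw of `h` from `S` to the rest of `I`, in another color, would combine with a perfect matching
of `B ∪ S.erase y`. So nearly all of that rest is isolated in `h`, which makes δ and m too large
together. -/
lemma false_of_card_eq_two (c : Config K d x h g φ) (b : Big h d a S B I) (hS : S.card = 2)
    (hK : 2 + a = K) (ha : 2 ≤ a) : False := by
  have h1 := c.count b
  have h2 := c.le_card
  have h3 := c.star_le
  have h4 := c.clique_le
  have h5 := c.first_le
  have hI : I.card = d + 1 := by have := b.card_I; omega
  set m := (pairs univ \ g).card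
  set δ := (missing h S B).card with hδ
  have hm : (0 : ℤ) ≤ m := by positivity
  have hδ0 : (0 : ℤ) ≤ δ := by positivity
  have haK : (a : ℤ) = K - 2 := by omega
  have hK4 : (4 : ℤ) ≤ K := by omega
  rw [hS, haK] at h1
  push_cast at h1
  have hmain : x + m + δ ≤ 2 * K ^ 2 - 3 * K + 1 + 2 * d := by nlinarith
  have hd3 : 3 ≤ d := by
    by_contra hd
    have hd2 : d = 2 := by have := c.two_le; omega
    have hK := c.five_le hd2
    have hK' : (5 : ℤ) ≤ K := by exact_mod_cast hK
    subst hd2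
    push_cast at *
    nlinarith
  have hd3' : (3 : ℤ) ≤ d := by exact_mod_cast hd3
  by_cases hind : ∀ u ∈ I, ∀ v ∈ I, s(u, v) ∉ g
  · have h6 := card_pairs_le_of_disjoint hind
    rw [hI] at h6
    push_cast at h6
    change _ ≤ 2 * (m : ℤ) at h6
    have hd4 : d < 4 := by
      by_contra hd4
      have : (4 : ℤ) ≤ d := by omega
      nlinarith
    have hd3 : d = 3 := by omega
    subst hd3
    push_cast at *
    nlinarith
  · push Not at hind
    obtain ⟨u, hu, v, hv, huv⟩ := hind
    have hne := c.ne_of_mem huv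
    have hδK : (δ : ℤ) + 4 < 2 * K := by
      by_contra hcon
      push Not at hcon
      have h7 : (K : ℤ) - 2 ≤ d := by nlinarith
      have h8 : 0 ≤ ((d : ℤ) - (K - 2)) * (K - 3) := by
        apply mul_nonneg <;> linarith
      nlinarith
    have hno : ∀ y ∈ S, ∀ w ∈ I \ {u, v}, s(y, w) ∉ h.erase (φ s(u, v)) := by
      intro y hy w hw hyw
      have hwI := (mem_sdiff.1 hw).1
      have hwuv : w ≠ u ∧ w ≠ v := by simpa using (mem_sdiff.1 hw).2
      have hP : (B ∪ S.erase y).card = 2 * (K - 1) := by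
        rw [card_union_of_disjoint, b.card_B, card_erase_of_mem hy]
        · omega
        · rw [disjoint_left]
          intro z hz hz'
          exact b.notMem_B_of_S (mem_of_mem_erase hz') hz
      have hM : HasMatch (h.erase (φ s(u, v))) (B ∪ S.erase y) (K - 1) := by
        apply hasMatch_of_card_even hP
        have h7 := Big.card_sdiff_le (h := h) (S := S) (B := B) (P := B ∪ S.erase y)
          (union_subset subset_union_right ((erase_subset _ _).trans subset_union_left)) (φ s(u, v))
        omega
      have hyw' : y ≠ w := fun e => b.notMem_I_of_S hy (e ▸ hwI)
      refine c.not_hasMatch_erase huv (Q := {y, w} ∪ (B ∪ S.erase y)) ?_ ?_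
        (((hasMatch_pair hyw' hyw).union hM ?_).mono Subset.rfl Subset.rfl (by omega))
      · have h1 := b.notMem_S_of_I hu
        have h2 : u ≠ y := fun e => h1 (e ▸ hy)
        simp [hwuv.1.symm, b.notMem_B_of_I hu, h1, h2]
      · have h1 := b.notMem_S_of_I hv
        have h2 : v ≠ y := fun e => h1 (e ▸ hy)
        simp [hwuv.2.symm, b.notMem_B_of_I hv, h1, h2]
      · simp [b.notMem_B_of_S hy, b.notMem_B_of_I hwI, b.notMem_S_of_I hwI]
    have hJc := card_sdiff_pair hu hv hne
    have h7 := Big.card_mul_le (B := B) Subset.rfl (disjoint_left.2 fun w hw hw' =>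
      b.notMem_I_of_S hw (mem_sdiff.1 hw').1) hno
    rw [hS] at h7
    have h8 := c.card_isolated_le_of_no_edge b sdiff_subset hno (q := (d : ℤ) - 2) (by omega)
      (by omega)
    change _ ≤ 2 * (m : ℤ) at h8
    have h9 : 2 * (d : ℤ) ≤ δ + 3 := by omega
    have h10 : x + m ≤ 2 * K ^ 2 - 3 * K + 4 := by linarith
    exact numeric_two (K := K) (d := d) (m := m) hK4 hd3' (by linarith) h8 (by linarith)
      (by linarith)

end Config

/-! ### The case |S| = 1 -/

namespace Config

lemma card_cross_sdiff_le (b : Big h d a S B I)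
    (hI : ∀ u ∈ I, ∀ v ∈ I, s(u, v) ∉ g) :
    (I.card : ℤ) * (I.card - 1) + 2 * (cross I B \ g).card ≤ 2 * (pairs univ \ g).card := by
  rw [← two_mul_card_pairs]
  have hsub : pairs I ∪ (cross I B \ g) ⊆ pairs univ \ g := by
    refine union_subset ?_ (sdiff_subset_sdiff (cross_subset_pairs b.disj.symm (subset_univ _)
      (subset_univ _)) Subset.rfl)
    intro e
    induction e with | _ u v
    intro he
    rw [mem_sdiff]
    rw [mk_mem_pairs] at he
    exact ⟨by simp [he.2.2], hI u he.1 v he.2.1⟩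
  have hdisj : Disjoint (pairs I) (cross I B \ g) := by
    rw [disjoint_left]
    intro e he he'
    obtain ⟨p, hp, q, hq, rfl⟩ := mem_cross.1 (mem_sdiff.1 he').1
    exact b.notMem_I_of_B hq (mk_mem_pairs.1 he).2.1
  have := card_le_card hsub
  rw [card_union_of_disjoint hdisj] at this
  zify at this
  linarith

/-- If fewer than `|B'|` pairs between `I` and `B` are missing from `g`, then every vertex of `I`
has a `g`-neighbor in `B' ⊆ B`. -/
lemma exists_mem_of_card_lt (b : Big h d a S B I) {u : V} (hu : u ∈ I) {B' : Finset V}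
    (hB' : B' ⊆ B) (hlt : (cross I B \ g).card < B'.card) : ∃ w ∈ B', s(u, w) ∈ g := by
  by_contra hcon
  push Not at hcon
  have hsub : cross {u} B' ⊆ cross I B \ g := by
    intro e he
    obtain ⟨p, hp, q, hq, rfl⟩ := mem_cross.1 he
    rw [mem_singleton.1 hp]
    exact mem_sdiff.2 ⟨mem_cross.2 ⟨u, hu, q, hB' hq, rfl⟩, hcon q hq⟩
  have := card_le_card hsub
  rw [card_cross (disjoint_singleton_left.2 fun hh => b.notMem_I_of_B (hB' hh) hu), card_singleton] at this
  omega

lemma numeric_one {K d m δ x : ℤ} (hK : 3 ≤ K) (hm : 0 ≤ m)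
    (hmain : x + m + δ ≤ 2 * K ^ 2 - 3 * K + 1 + (2 * K + d - 3)) (hδ : 2 * K - 2 ≤ δ)
    (hstar : (K - 1) * (3 * K + 2 * d) ≤ 2 * x) : 2 * d + 1 ≤ K := by
  have h1 : 2 * d * (K - 2) ≤ K * (K - 3) := by linarith
  by_contra hcon
  push Not at hcon
  have h2 : 0 ≤ (2 * d - K) * (K - 2) := by apply mul_nonneg <;> linarith
  nlinarith

lemma numeric_one' {K d m δ x : ℤ} (hK : 3 ≤ K) (hm : d * (d - 1) ≤ 2 * m) (hδ : 0 ≤ δ)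
    (hmain : x + m + δ ≤ 2 * K ^ 2 - 3 * K + 1 + (2 * K + d - 3))
    (hstar : (K - 1) * (3 * K + 2 * d) ≤ 2 * x) : d + 3 ≤ 2 * K := by
  have h1 : d ^ 2 + 2 * d * K - 5 * d ≤ K ^ 2 + K - 4 := by linarith
  by_contra hcon
  push Not at hcon
  have h2 : 0 ≤ (d - (2 * K - 2)) * (d + 4 * K - 7) := by apply mul_nonneg <;> linarith
  nlinarith

/-- The 2K vertices of `S ∪ B` have no perfect matching in `h` without the color of uv, so δ ≥ 2K -
2 and d is small compared with K. Then `B` still has an a-matching, so z has at most one neighbor in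
the rest of `I`, and the first term of the maximum rules out such parameters. -/
lemma false_of_card_eq_one_of_mem (c : Config K d x h g φ) (b : Big h d a S B I) {z : V}
    (hS : S = {z}) (hK : 1 + a = K) (ha : 2 ≤ a) {u v : V} (hu : u ∈ I) (hv : v ∈ I)
    (huv : s(u, v) ∈ g) : False := by
  have hzS : z ∈ S := by simp [hS]
  have h1 := c.count b
  have h2 := c.le_card
  have h3 := c.star_le
  have h5 := c.first_le
  have hI : I.card = d := by have := b.card_I; rw [hS, card_singleton] at this; omega
  set m := (pairs univ \ g).card
  set δ := (missing h S B).card with hδ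
  have hm : (0 : ℤ) ≤ m := by positivity
  have haK : (a : ℤ) = K - 1 := by omega
  have hK3 : (3 : ℤ) ≤ K := by omega
  have hd2 : (2 : ℤ) ≤ d := by exact_mod_cast c.two_le
  rw [hS, card_singleton, haK] at h1
  push_cast at h1
  have hmain : x + m + δ ≤ 2 * K ^ 2 - 3 * K + 1 + (2 * K + d - 3) := by linarith
  have hne := c.ne_of_mem huv
  have hSB : (S ∪ B).card = 2 * K := by
    rw [card_union_of_disjoint (disjoint_left.2 fun w hw => b.notMem_B_of_S hw), b.card_B, hS,
      card_singleton]
    omega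
  have hδK : 2 * (K : ℤ) - 2 ≤ δ := by
    by_contra hcon
    push Not at hcon
    refine c.not_hasMatch_erase huv (Q := S ∪ B) ?_ ?_ (hasMatch_of_card_even hSB ?_)
    · simp [b.notMem_S_of_I hu, b.notMem_B_of_I hu]
    · simp [b.notMem_S_of_I hv, b.notMem_B_of_I hv]
    · have := Big.card_sdiff_le (h := h) (S := S) (B := B) Subset.rfl (φ s(u, v))
      omega
  have hKd := numeric_one hK3 hm hmain hδK h3
  have hx := c.clique_le
  have hδle : (δ : ℤ) ≤ 2 * K + d - 3 := by linarith
  have hno : ∀ y ∈ S, ∀ w ∈ I \ {u, v}, s(y, w) ∉ h.erase (φ s(u, v)) := by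
    intro y hy w hw hyw
    have hwI := (mem_sdiff.1 hw).1
    have hwuv : w ≠ u ∧ w ≠ v := by simpa using (mem_sdiff.1 hw).2
    have hM : HasMatch (h.erase (φ s(u, v))) B a := by
      apply hasMatch_of_card_odd b.card_B
      have h7 := Big.card_sdiff_le (h := h) (S := S) (B := B) subset_union_right (φ s(u, v))
      omega
    have hyw' : y ≠ w := fun e => b.notMem_I_of_S hy (e ▸ hwI)
    refine c.not_hasMatch_erase huv (Q := {y, w} ∪ B) ?_ ?_
      (((hasMatch_pair hyw' hyw).union hM ?_).mono Subset.rfl Subset.rfl (by omega))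
    · have h1 := b.notMem_S_of_I hu
      have h2 : u ≠ y := fun e => h1 (e ▸ hy)
      simp [hwuv.1.symm, b.notMem_B_of_I hu, h2]
    · have h1 := b.notMem_S_of_I hv
      have h2 : v ≠ y := fun e => h1 (e ▸ hy)
      simp [hwuv.2.symm, b.notMem_B_of_I hv, h2]
    · simp [b.notMem_B_of_S hy, b.notMem_B_of_I hwI]
  have hJc := card_sdiff_pair hu hv hne
  rcases Nat.lt_or_ge d 3 with hd | hd
  · have hd2 : d = 2 := by omega
    subst hd2
    push_cast at *
    nlinarith
  · have h8 := c.card_isolated_le_of_no_edge b sdiff_subset hno (q := (d : ℤ) - 3) (by omega)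
      (by omega)
    change _ ≤ 2 * (m : ℤ) at h8
    nlinarith

/-- Independence of `I` makes m large, so few pairs between `I` and `B` are missing from `g`. A
g-edge uy from `I` to `B` leaves a perfect matching of `B.erase y`, so every h-edge from z to
`I.erase u` must represent the color of uy. This forces |I| = 2, where two such edges are used at
once. -/
lemma false_of_card_eq_one_of_indep (c : Config K d x h g φ) (b : Big h d a S B I) {z : V}
    (hS : S = {z}) (hK : 1 + a = K) (ha : 2 ≤ a) (hind : ∀ u ∈ I, ∀ v ∈ I, s(u, v) ∉ g) :
    False := by
  have hzS : z ∈ S := by simp [hS]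
  have hzB := b.notMem_B_of_S hzS
  have hzI := b.notMem_I_of_S hzS
  have h1 := c.count b
  have h2 := c.le_card
  have h5 := c.first_le
  have hI : I.card = d := by have := b.card_I; rw [hS, card_singleton] at this; omega
  have hd2 := c.two_le
  have hp := card_cross_sdiff_le b hind
  set m := (pairs univ \ g).card
  set δ := (missing h S B).card with hδ
  set p := (cross I B \ g).card with hpdef
  have haK : (a : ℤ) = K - 1 := by omega
  have hK3 : (3 : ℤ) ≤ K := by omega
  rw [hS, card_singleton, haK] at h1
  push_cast at h1
  rw [hI] at hp
  have hmain : x + m + δ ≤ 2 * K ^ 2 - 3 * K + 1 + (2 * K + d - 3) := by linarith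
  have hdK := numeric_one' hK3 (by linarith) (by positivity) hmain c.star_le
  have hδp : (δ : ℤ) + p + 2 ≤ d := by linarith
  have hex : ∀ u ∈ I, ∃ w ∈ B, s(u, w) ∈ g := fun u hu =>
    exists_mem_of_card_lt b hu Subset.rfl (by rw [b.card_B]; omega)
  have hkey : ∀ u ∈ I, ∀ y ∈ B, s(u, y) ∈ g → ∀ w ∈ I, w ≠ u → s(z, w) ∈ h →
      s(z, w) = φ s(u, y) := by
    intro u hu y hy huy w hw hwu hzw
    by_contra hne
    have hzw' : z ≠ w := fun e => hzI (e ▸ hw)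
    have hM : HasMatch (h.erase (φ s(u, y))) (B.erase y) a := by
      apply hasMatch_of_card_even
      · rw [card_erase_of_mem hy, b.card_B]; omega
      · have h7 := Big.card_sdiff_le (h := h) (S := S) (B := B)
          ((erase_subset y B).trans subset_union_right) (φ s(u, y))
        omega
    refine c.not_hasMatch_erase huy (Q := {z, w} ∪ B.erase y) ?_ ?_
      (((hasMatch_pair hzw' (mem_erase.2 ⟨hne, hzw⟩)).union hM ?_).mono Subset.rfl Subset.rfl
        (by omega))
    · have h2 : u ≠ z := fun e => hzI (e ▸ hu)
      simp [h2, hwu.symm, b.notMem_B_of_I hu]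
    · have h2 : y ≠ z := fun e => hzB (e ▸ hy)
      have h3 : y ≠ w := fun e => b.notMem_I_of_B hy (e ▸ hw)
      simp [h2, h3]
    · simp [hzB, b.notMem_B_of_I hw]
  obtain ⟨w₁, hw₁, w₂, hw₂, hw⟩ : ∃ w₁ ∈ I.filter fun w => s(z, w) ∈ h,
      ∃ w₂ ∈ I.filter fun w => s(z, w) ∈ h, w₁ ≠ w₂ := by
    apply one_lt_card.1
    have h6 : (I.filter fun w => s(z, w) ∈ h).card + (I.filter fun w => s(z, w) ∉ h).card = d := by
      rw [← hI]; exact card_filter_add_card_filter_not _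
    have h7 : cross {z} (I.filter fun w => s(z, w) ∉ h) ⊆ missing h S B := by
      apply Big.cross_subset_missing (by simp [hS])
      · exact disjoint_of_subset_right (filter_subset _ _)
          (disjoint_left.2 fun w hw => b.notMem_I_of_S hw)
      · intro y hy w hw
        rw [mem_singleton.1 hy]
        exact (mem_filter.1 hw).2
    have h8 := card_le_card h7
    rw [card_cross (by simp [hzI]), card_singleton] at h8
    omega
  obtain ⟨hw₁I, hw₁h⟩ := mem_filter.1 hw₁
  obtain ⟨hw₂I, hw₂h⟩ := mem_filter.1 hw₂
  -- For a third vertex u, one color would be represented by both zw₁ and zw₂.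
  have hsub : I ⊆ {w₁, w₂} := by
    intro u hu
    by_contra hcon
    simp only [mem_insert, mem_singleton, not_or] at hcon
    obtain ⟨y, hy, huy⟩ := hex u hu
    have h6 := hkey u hu y hy huy w₁ hw₁I (Ne.symm hcon.1) hw₁h
    rw [← hkey u hu y hy huy w₂ hw₂I (Ne.symm hcon.2) hw₂h] at h6
    exact hw (Sym2.congr_right.1 h6)
  have hd : d = 2 := by
    have h6 := card_le_card hsub
    have h7 := card_le_two (a := w₁) (b := w₂)
    omega
  obtain ⟨y₁, hy₁, hwy₁⟩ := hex w₁ hw₁I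
  obtain ⟨y₂, hy₂, hwy₂⟩ := exists_mem_of_card_lt (g := g) b hw₂I (erase_subset y₁ B)
    (by rw [card_erase_of_mem hy₁, b.card_B]; omega)
  obtain ⟨hy, hy₂⟩ := mem_erase.1 hy₂
  have hφ₁ := hkey w₁ hw₁I y₁ hy₁ hwy₁ w₂ hw₂I hw.symm hw₂h
  have hφ₂ := hkey w₂ hw₂I y₂ hy₂ hwy₂ w₁ hw₁I hw hw₁h
  have hwy : ∀ w ∈ I, ∀ y ∈ B, w ≠ y := fun w hw y hy e => b.notMem_I_of_B hy (e ▸ hw)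
  have hQ : (S ∪ B \ {y₁, y₂}).card = 2 * a := by
    rw [card_union_of_disjoint, hS, card_singleton]
    · have := card_sdiff_pair hy₁ hy₂ hy.symm
      rw [b.card_B] at this
      omega
    · rw [disjoint_left]
      intro w hw hw'
      exact b.notMem_B_of_S hw (mem_sdiff.1 hw').1
  have hM : HasMatch h (S ∪ B \ {y₁, y₂}) a := by
    apply hasMatch_of_card_even hQ
    have := card_le_card (Big.sdiff_subset_missing (h := h) (S := S) (B := B)
      (show S ∪ B \ {y₁, y₂} ⊆ S ∪ B from union_subset_union_right sdiff_subset))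
    omega
  have hnot : ∀ w ∈ I, w ∉ S ∪ B \ {y₁, y₂} := by
    intro w hw
    simp [b.notMem_S_of_I hw, b.notMem_B_of_I hw]
  have hynot : y₁ ∉ S ∧ y₂ ∉ S :=
    ⟨fun hh => b.notMem_B_of_S hh hy₁, fun hh => b.notMem_B_of_S hh hy₂⟩
  -- The colors of w₁y₁ and w₂y₂ are represented by zw₂ and zw₁, which are distinct and not inside
  -- `S ∪ B \ {y₁, y₂}`. A perfect matching of that set supplies the other a = K - 1 edges.
  refine c.false_of_two_edges hwy₁ hwy₂ ?_ ?_ ?_ ?_ ?_ (by omega) hM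
  · simp [hw.symm, hy, (hwy w₁ hw₁I y₂ hy₂).symm, hwy w₂ hw₂I y₁ hy₁]
  · rw [← hφ₁, ← hφ₂]
    intro e
    exact hw (Sym2.congr_right.1 e).symm
  · rw [disjoint_left]
    intro w hw'
    simp only [mem_union, mem_insert, mem_singleton] at hw'
    rcases hw' with (rfl | rfl) | (rfl | rfl)
    · exact hnot _ hw₁I
    · simp [hynot]
    · exact hnot _ hw₂I
    · simp [hynot]
  · rw [← hφ₁, mk_mem_pairs]
    exact fun hh => hnot _ hw₂I hh.2.1
  · rw [← hφ₂, mk_mem_pairs]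
    exact fun hh => hnot _ hw₁I hh.2.1

lemma false_of_card_eq_one (c : Config K d x h g φ) (b : Big h d a S B I) (hS : S.card = 1)
    (hK : 1 + a = K) (ha : 2 ≤ a) : False := by
  obtain ⟨z, hz⟩ := card_eq_one.1 hS
  by_cases hind : ∀ u ∈ I, ∀ v ∈ I, s(u, v) ∉ g
  · exact c.false_of_card_eq_one_of_indep b hz hK ha hind
  · push Not at hind
    obtain ⟨u, hu, v, hv, huv⟩ := hind
    exact c.false_of_card_eq_one_of_mem b hz hK ha hu hv huv

end Config

/-! ### The case of empty `S` -/

namespace Config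

lemma numeric_zero {K d m δ p x : ℤ} (hK1 : 1 ≤ K) (hd2 : 2 ≤ d) (hn : 12 ≤ 2 * K + d)
    (hδ : 0 ≤ δ) (hp : 0 ≤ p) (hm : (d - 1) * (d - 2) + 2 * p ≤ 2 * m)
    (hmain : x + m + δ ≤ 2 * K ^ 2 + K - 2) (h0 : (K - 1) * (2 * K - 1) ≤ x)
    (h1 : (K - 1) * (3 * K + 2 * d) ≤ 2 * x)
    (h2 : 2 * K * (2 * K - 1) - d * (d - 1) ≤ 2 * x) :
    4 ≤ K ∧ d + 1 ≤ 2 * K ∧ δ + 8 ≤ 4 * K ∧ δ + p + 3 ≤ 2 * K + d := by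
  have e0 : (d - 1) * (d - 2) + 2 * p + 2 * δ ≤ 8 * K - 6 := by linarith
  have e2 : δ + p + 3 ≤ 2 * K + d := by linarith
  have hK : 4 ≤ K := by
    by_contra hcon
    have : 6 ≤ d := by omega
    interval_cases K <;> nlinarith
  refine ⟨hK, ?_, ?_, e2⟩
  · by_contra hcon
    have : 2 * K ≤ d := by omega
    nlinarith
  · rcases le_or_gt 5 d with h5 | h5
    · nlinarith
    · interval_cases d
      · omega
      · omega
      · rcases le_or_gt 5 K with h5 | h5
        · omega
        · have : K = 4 := by omega
          subst this
          omega

/-- Every g-edge vy from `I` to `B` must destroy the perfect matchings of `B.erase y`, and so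
isolates a vertex there once its color is removed. Such a vertex has at most two h-neighbors in `B`,
and only one vertex can have so few. Either it can itself play the role of y, or too few vertices of
`B` can have g-neighbors in `I`. -/
lemma false_of_card_eq_zero (c : Config K d x h g φ) (b : Big h d K ∅ B I) : False := by
  have h1 := c.count b
  have h2 := c.le_card
  have hI : I.card + 1 = d := by have := b.card_I; simpa using this
  have hiso : ∀ u ∈ I, ∀ w, u ≠ w → s(u, w) ∉ h := fun u hu => b.isolated hu (by simp)
  have hp := card_cross_sdiff_le b fun u hu v hv => c.notMem_of_isolated (hiso u hu) (hiso v hv)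
  set m := (pairs univ \ g).card
  set δ := (missing h ∅ B).card with hδ
  set p := (cross I B \ g).card with hpdef
  have hIz : (I.card : ℤ) = d - 1 := by omega
  rw [hIz] at hp
  rw [card_empty] at h1
  push_cast at h1
  obtain ⟨hK4, hdK, hδK, hδp⟩ := numeric_zero (K := K) (d := d) (m := m) (δ := δ) (p := p) (x := x)
    (by exact_mod_cast c.one_le) (by exact_mod_cast c.two_le) (by exact_mod_cast c.twelve_le)
    (by positivity) (by positivity) (by linarith) (by linarith) c.clique_le c.star_le c.first_le
  have hmissB : pairs B \ h ⊆ missing h ∅ B := Big.sdiff_subset_missing subset_union_right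
  -- the non-neighbors of a vertex of `B`
  let N : V → Finset V := fun z => B.filter fun w => z ≠ w ∧ s(z, w) ∈ h
  let N' : V → Finset V := fun z => B.filter fun w => ¬ (z ≠ w ∧ s(z, w) ∈ h)
  have hNN' : ∀ z, (N z).card + (N' z).card = 2 * K + 1 := fun z => by
    rw [← b.card_B]; exact card_filter_add_card_filter_not _
  have hzN' : ∀ z ∈ B, z ∈ N' z := fun z hz => by simp [N', hz]
  have hmissz : ∀ z ∈ B, cross {z} ((N' z).erase z) ⊆ pairs B \ h := by
    intro z hz e he
    obtain ⟨y, hy, w, hw, rfl⟩ := mem_cross.1 he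
    rw [mem_singleton.1 hy]
    obtain ⟨h3, h4⟩ := mem_erase.1 hw
    obtain ⟨h5, h6⟩ := mem_filter.1 h4
    rw [mem_sdiff, mk_mem_pairs]
    exact ⟨⟨hz, h5, h3.symm⟩, fun hh => h6 ⟨h3.symm, hh⟩⟩
  have hcardz : ∀ z ∈ B, (cross {z} ((N' z).erase z)).card + (N z).card = 2 * K := by
    intro z hz
    rw [card_cross (by simp), card_singleton, one_mul, card_erase_of_mem (hzN' z hz)]
    have := hNN' z
    have := card_pos.2 ⟨z, hzN' z hz⟩
    omega
  have hδB := card_le_card hmissB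
  -- an edge between `I` and `B` yields a vertex of small degree
  have hsmall : ∀ v ∈ I, ∀ y ∈ B, s(v, y) ∈ g →
      ∃ z ∈ B, z ≠ y ∧ ((N z).erase y).card ≤ 1 := by
    intro v hv y hy hvy
    have hPc : (B.erase y).card = 2 * K := by rw [card_erase_of_mem hy, b.card_B]; omega
    have H := c.not_hasMatch_erase hvy (Q := B.erase y)
      (fun hh => b.notMem_B_of_I hv (mem_of_mem_erase hh)) (notMem_erase y B)
    obtain ⟨z, hz, hzw⟩ := exists_isolated_of_not_hasMatch (by omega) hPc (by
      have := Big.card_sdiff_le (h := h) (S := ∅) (B := B)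
        ((erase_subset y B).trans subset_union_right) (φ s(v, y))
      omega) H
    obtain ⟨hzy, hzB⟩ := mem_erase.1 hz
    refine ⟨z, hzB, hzy, ?_⟩
    have key : ∀ w ∈ (N z).erase y, s(z, w) = φ s(v, y) := by
      intro w hw
      obtain ⟨h3, h4⟩ := mem_erase.1 hw
      obtain ⟨h5, h6⟩ := mem_filter.1 h4
      by_contra hne
      exact hzw w (mem_erase.2 ⟨h3, h5⟩) h6.1 (mem_erase.2 ⟨hne, h6.2⟩)
    rw [card_le_one]
    intro w hw w' hw'
    exact Sym2.congr_right.1 ((key w hw).trans (key w' hw').symm)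
  have hN2 : ∀ z y, ((N z).erase y).card ≤ 1 → (N z).card ≤ 2 := by
    intro z y hzy
    have := pred_card_le_card_erase (s := N z) (a := y)
    omega
  -- Each such vertex misses at least 2K - 2 pairs in `B` and two of them share at most one, so two
  -- would miss 4K - 5, more than δ ≤ 4K - 8.
  have hunique : ∀ z ∈ B, ∀ z' ∈ B, (N z).card ≤ 2 → (N z').card ≤ 2 → z = z' := by
    intro z hz z' hz' h3 h4
    by_contra hne
    have h5 := card_le_card (union_subset (hmissz z hz) (hmissz z' hz'))
    have h6 := card_union_add_card_inter (cross {z} ((N' z).erase z)) (cross {z'} ((N' z').erase z'))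
    have h7 : (cross {z} ((N' z).erase z) ∩ cross {z'} ((N' z').erase z')).card ≤ 1 := by
      rw [card_le_one]
      have key : ∀ e ∈ cross {z} ((N' z).erase z) ∩ cross {z'} ((N' z').erase z'),
          e = s(z, z') := by
        intro e he
        obtain ⟨he1, he2⟩ := mem_inter.1 he
        obtain ⟨y, hy, w, hw, rfl⟩ := mem_cross.1 he1
        obtain ⟨y', hy', w', hw', heq⟩ := mem_cross.1 he2
        rw [mem_singleton] at hy hy'
        subst hy hy'
        rcases Sym2.eq_iff.1 heq with ⟨h8, _⟩ | ⟨h8, _⟩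
        · exact absurd h8.symm hne
        · rw [h8]
      intro e he e' he'
      rw [key e he, key e' he']
    have h8 := hcardz z hz
    have h9 := hcardz z' hz'
    omega
  obtain ⟨v₀, hv₀⟩ := card_pos.1 (show 0 < I.card by have := c.two_le; omega)
  have hpI : ∀ B' ⊆ B, (∀ v ∈ I, ∀ y ∈ B', s(v, y) ∉ g) → I.card * B'.card ≤ p := by
    intro B' hB' hno
    rw [← card_cross (disjoint_of_subset_right hB' b.disj.symm)]
    apply card_le_card
    intro e he
    obtain ⟨v, hv, y, hy, rfl⟩ := mem_cross.1 he
    exact mem_sdiff.2 ⟨mem_cross.2 ⟨v, hv, y, hB' hy, rfl⟩, hno v hv y hy⟩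
  obtain ⟨v, hv, y, hy, hvy⟩ : ∃ v ∈ I, ∃ y ∈ B, s(v, y) ∈ g := by
    by_contra hcon
    push Not at hcon
    have h3 := hpI B Subset.rfl hcon
    rw [b.card_B] at h3
    have : 1 ≤ I.card := card_pos.2 ⟨v₀, hv₀⟩
    have : I.card * 1 + 1 * (2 * K) ≤ I.card * (2 * K + 1) := by nlinarith
    omega
  obtain ⟨z, hzB, hzy, hz⟩ := hsmall v hv y hy hvy
  have hz2 := hN2 z y hz
  have hmz := card_le_card (hmissz z hzB)
  have hcz := hcardz z hzB
  rcases Nat.lt_or_ge (N z).card 2 with hlt | hge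
  -- The vertex z alone accounts for at least 2K - 1 missing pairs. Without a g-edge to `I` it would
  -- add d - 1 more, too many. Deleting z then leaves `B` complete enough for a perfect matching.
  · obtain ⟨u, hu, huz⟩ : ∃ u ∈ I, s(u, z) ∈ g := by
      by_contra hcon
      push Not at hcon
      have := hpI {z} (by simpa using hzB) (by simpa using hcon)
      rw [card_singleton, mul_one] at this
      omega
    refine c.not_hasMatch_erase huz (Q := B.erase z)
      (fun hh => b.notMem_B_of_I hu (mem_of_mem_erase hh)) (notMem_erase z B)
      (hasMatch_of_card_even ?_ ?_)
    · rw [card_erase_of_mem hzB, b.card_B]; omega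
    · have h3 := card_sdiff_erase_le h (φ s(u, z)) (pairs (B.erase z))
      have h4 : (pairs (B.erase z) \ h) ∪ cross {z} ((N' z).erase z) ⊆ pairs B \ h :=
        union_subset (sdiff_subset_sdiff (pairs_mono (erase_subset _ _)) Subset.rfl) (hmissz z hzB)
      have h5 : Disjoint (pairs (B.erase z) \ h) (cross {z} ((N' z).erase z)) := by
        rw [disjoint_left]
        intro e he he'
        obtain ⟨y, hy, w, hw, rfl⟩ := mem_cross.1 he'
        rw [mem_singleton.1 hy] at he
        exact notMem_erase z B (mk_mem_pairs.1 (mem_sdiff.1 he).1).1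
      have h6 := card_le_card h4
      rw [card_union_of_disjoint h5] at h6
      omega
  -- A g-edge to such a y would again produce z by uniqueness, but both h-neighbors of z survive the
  -- deletion of y.
  · have h3 : ∀ v ∈ I, ∀ y ∈ (B.erase z) \ N z, s(v, y) ∉ g := by
      intro v hv y hy hvy
      obtain ⟨hy1, hy2⟩ := mem_sdiff.1 hy
      obtain ⟨z', hz'B, -, hz'⟩ := hsmall v hv y (mem_of_mem_erase hy1) hvy
      have := hunique z hzB z' hz'B hz2 (hN2 z' y hz')
      subst this
      rw [erase_eq_of_notMem hy2] at hz'
      omega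
    have h4 := hpI _ (sdiff_subset.trans (erase_subset _ _)) h3
    have h5 := le_card_sdiff (N z) (B.erase z)
    rw [card_erase_of_mem hzB, b.card_B] at h5
    have h6 : 2 ≤ ((B.erase z) \ N z).card := by omega
    have : 1 ≤ I.card := card_pos.2 ⟨v₀, hv₀⟩
    have h7 : I.card * 2 ≤ I.card * ((B.erase z) \ N z).card := Nat.mul_le_mul_left _ h6
    omega

end Config

/-! ### The case |S| ≥ 3, the sparse case, and the conclusion -/

/-- Convexity of the Erdős–Gallai bound in `s`. -/
lemma convex_bound {s a d x E t : ℤ} (hs : 0 ≤ s) (ha : 1 ≤ a) (hsa : 1 < s + a)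
    (hE : 2 * E ≤ s * (2 * (2 * (s + a) + d) - s - 1) + (2 * a - 1) * (2 * a - 2) + t)
    (hx : x + 2 ≤ E) (h0 : (s + a - 1) * (2 * (s + a) - 1) ≤ x)
    (h1 : (s + a - 1) * (3 * (s + a) + 2 * d) ≤ 2 * x) : 3 * s * (a - 1) + 4 ≤ t := by
  -- The clique and star bounds are the values at the two ends s = 0 and a = 1. The weights a - 1
  -- and s place their average at the current s, where the chord exceeds the convex function by 3s(a
  -- - 1) in doubled counts; `t` must cover that excess and the 4.
  have e0 := mul_le_mul_of_nonneg_left h0 (show 0 ≤ a - 1 by linarith)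
  have e1 := mul_le_mul_of_nonneg_left h1 hs
  have e2 := mul_le_mul_of_nonneg_left (show 2 * x + 4 ≤
    s * (2 * (2 * (s + a) + d) - s - 1) + (2 * a - 1) * (2 * a - 2) + t by linarith)
    (show 0 ≤ s + a - 1 by linarith)
  have key : 0 ≤ (s + a - 1) * (t - 4 - 3 * s * (a - 1)) := by linarith
  have := nonneg_of_mul_nonneg_right key (by linarith)
  linarith

namespace Config

lemma false_of_three_le (c : Config K d x h g φ) (b : Big h d a S B I) (hS : 3 ≤ S.card)
    (hK : S.card + a = K) (ha : 2 ≤ a) : False := by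
  have h1 := c.count b
  have h2 := c.le_card
  have h3 := c.star_le
  have h4 := c.clique_le
  have h5 := c.first_le
  have hd := c.two_le
  have hm : (0 : ℤ) ≤ (pairs univ \ g).card := by positivity
  have hδ : (0 : ℤ) ≤ (missing h S B).card := by positivity
  have hK' : (K : ℤ) = S.card + a := by omega
  rw [hK'] at h1 h3 h4 h5
  -- Here `t` is (2a + 1)(2a) - (2a - 1)(2a - 2), the cost of a clique on 2a + 1 rather than 2a - 1
  -- vertices. Only |S| = 3 with a ≤ 3 survives; the star bound then gives d = 2, which the first
  -- term excludes.
  have key := convex_bound (s := S.card) (a := a) (d := d) (x := x) (E := h.card)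
    (t := 2 * (4 * a - 1)) (by positivity) (by omega) (by omega) (by linarith) (by linarith) h4 h3
  have hS3 : S.card = 3 := by
    by_contra hne
    have h6 : (4 : ℤ) ≤ S.card := by omega
    have h7 : (2 : ℤ) ≤ a := by omega
    nlinarith
  rw [hS3] at key h1 h3 h4 h5
  have ha3 : a ≤ 3 := by omega
  have hd2 : (2 : ℤ) ≤ d := by exact_mod_cast hd
  interval_cases a
  · have : (d : ℤ) ≤ 2 := by push_cast at *; linarith
    have : (d : ℤ) = 2 := by omega
    rw [this] at h1 h5
    push_cast at *
    linarith
  · have : (d : ℤ) ≤ 2 := by push_cast at *; linarith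
    have : (d : ℤ) = 2 := by omega
    rw [this] at h1 h5
    push_cast at *
    linarith

/-- For the sparse case with empty barrier: h barely exceeds the clique bound, so the star bound
makes K large against d while the first term makes d² large against K. Together they push d up to 9.
-/
lemma numeric_small {K d x m : ℤ} (hK : 2 ≤ K) (hd : 2 ≤ d)
    (hx : x + m ≤ (K - 1) * (2 * K - 1) + 1) (hm : 0 ≤ m)
    (h1 : (K - 1) * (3 * K + 2 * d) ≤ 2 * x)
    (h2 : 2 * K * (2 * K - 1) - d * (d - 1) ≤ 2 * x) : 9 ≤ d ∧ 4 ≤ K := by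
  have e1 : 2 * d * (K - 1) ≤ K ^ 2 - 3 * K + 4 := by linarith
  have e2 : 4 * K ≤ d ^ 2 - d + 4 := by linarith
  have hKd : 2 * d + 1 ≤ K := by
    by_contra hcon
    have h3 : 0 ≤ (2 * d - K) * (K - 1) := by apply mul_nonneg <;> linarith
    have h4 : K ≤ 2 := by linarith
    have h5 : K = 2 := by linarith
    subst h5
    linarith
  have : 9 ≤ d := by nlinarith
  exact ⟨this, by linarith⟩

/-- There is no counterexample. -/
theorem false (c : Config K d x h g φ) : False := by
  obtain ⟨S, hS, a, ha, hstr⟩ := exists_structure c.two_le c.card_univ c.not_hasMatch_univ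
  rcases hstr with ⟨B, I, h1, h2, h3, h4, h5⟩ | ⟨h1, h2, h3⟩
  · have b : Big h d a S B I := ⟨h1, h2, h3, h4, h5⟩
    rcases Nat.lt_or_ge a 2 with ha2 | ha2
    · interval_cases a
      · exact c.false_of_card_eq b ha
      · exact c.false_of_card_add_one_eq b ha
    · rcases Nat.lt_or_ge S.card 3 with hS3 | hS3
      · interval_cases hSc : S.card
        · rw [card_eq_zero] at hSc
          subst hSc
          rw [zero_add] at ha
          subst ha
          exact c.false_of_card_eq_zero b
        · exact c.false_of_card_eq_one b hSc ha ha2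
        · exact c.false_of_card_eq_two b hSc ha ha2
      · exact c.false_of_three_le b hS3 ha ha2
  · have h4 := two_mul_card_inter_pairs_le_of_sdiff h hS
    rw [inter_eq_left.2 (c.subset.trans c.subset_pairs), c.card_univ] at h4
    have h5 := c.le_card
    have h6 := c.clique_le
    have h7 := c.star_le
    have h8 := c.first_le
    have hm : (0 : ℤ) ≤ (pairs univ \ g).card := by positivity
    have hd2 : (2 : ℤ) ≤ d := by exact_mod_cast c.two_le
    have ha2 : (2 : ℤ) ≤ a := by exact_mod_cast h1
    push_cast at h4
    rcases Nat.eq_zero_or_pos S.card with hS0 | hS0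
    · rw [card_eq_zero] at hS0
      subst hS0
      rw [card_empty, zero_add] at ha
      subst ha
      rw [card_empty] at h4 h3
      rw [sdiff_empty] at h2 h3 h4
      push_cast at h4
      obtain ⟨hd9, hK4⟩ := numeric_small (K := a) (d := d) (x := x) (m := (pairs univ \ g).card) ha2
        hd2 (by linarith) hm h7 h8
      -- The sharper edge bound falls below the clique bound once K ≥ 4. Otherwise at least d - 3 ≥
      -- 6 isolated vertices make m large, while m ≤ 1.
      rcases h3 with h3 | ⟨J, -, hJ, hiso⟩
      · nlinarith
      · have h9 := c.card_isolated_le (J := J) fun u hu w huw => hiso u hu w (mem_univ _) huw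
        have h10 : (d : ℤ) - 3 ≤ J.card := by omega
        nlinarith
    · have hK' : (K : ℤ) = S.card + a := by omega
      rw [hK'] at h4 h6 h7
      have hS1 : (1 : ℤ) ≤ S.card := by exact_mod_cast hS0
      have key := convex_bound (s := S.card) (a := a) (d := d) (x := x) (E := h.card)
        (t := 6) (by linarith) (by linarith) (by linarith) (by linarith) (by linarith) h6 h7
      nlinarith

end Config

end

/-! ### Matchings and the extremal number of `matchingGraph` -/

section
variable {V : Type u}

lemma card_le_of_touch {M : Finset (Sym2 V)} (hM : IsMatch M) {S : Finset V}
    (hS : ∀ e ∈ M, ∃ y ∈ S, y ∈ e) : M.card ≤ S.card := by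
  classical
  rcases M.eq_empty_or_nonempty with rfl | ⟨e₀, he₀⟩
  · simp
  obtain ⟨y₀, -, -⟩ := hS e₀ he₀
  have : Nonempty V := ⟨y₀⟩
  choose! f hf using hS
  refine card_le_card_of_injOn f (fun e he => (hf e he).1) ?_
  intro e he e' he' heq
  by_contra hne
  exact hM e he e' he' hne _ (hf e he).2 (heq ▸ (hf e' he').2)

lemma two_mul_le_card {M : Finset (Sym2 V)} (hM : IsMatch M) {P : Finset V} (hP : M ⊆ pairs P) :
    2 * M.card ≤ P.card := by
  classical
  have hdis : (M : Set (Sym2 V)).PairwiseDisjoint fun e => P.filter (· ∈ e) := by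
    intro e he e' he' hne
    rw [Function.onFun, disjoint_left]
    intro v hv hv'
    exact hM e he e' he' hne v (mem_filter.1 hv).2 (mem_filter.1 hv').2
  have h2 : ∀ e ∈ M, 2 ≤ (P.filter (· ∈ e)).card := by
    intro e he
    have := hP he
    induction e with | _ u v
    rw [mk_mem_pairs] at this
    rw [← card_pair this.2.2]
    apply card_le_card
    intro w hw
    rcases mem_insert.1 hw with rfl | hw
    · simp [this.1]
    · rw [mem_singleton.1 hw]; simp [this.2.1]
  have h3 : (M.biUnion fun e => P.filter (· ∈ e)).card ≤ P.card :=
    card_le_card (biUnion_subset.2 fun e _ => filter_subset _ _)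
  rw [card_biUnion hdis] at h3
  have := card_nsmul_le_sum M _ 2 h2
  rw [smul_eq_mul] at this
  omega

lemma isContained_of_hasMatch [Fintype V] {G : SimpleGraph V} {h : Finset (Sym2 V)} {m : ℕ}
    (hG : ∀ e ∈ h, e ∈ G.edgeSet) (H : HasMatch h univ m) : (matchingGraph m).IsContained G := by
  obtain ⟨M, h1, h2, h3, h4⟩ := H
  let ε : Fin m ≃ M := (Fintype.equivFinOfCardEq (by simpa using h4)).symm
  let f : Fin m × Bool → V := fun p => if p.2 then (Quot.out (ε p.1).1).1 else (Quot.out (ε p.1).1).2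
  have hf : ∀ i, s(f (i, true), f (i, false)) = (ε i).1 := fun i => by
    simp only [f, if_true, Bool.false_eq_true, if_false]
    exact Quot.out_eq (ε i).1
  have hne : ∀ i, f (i, true) ≠ f (i, false) := by
    intro i
    have := h2 (ε i).2
    rw [← hf i, mk_mem_pairs] at this
    exact this.2.2
  have hmem : ∀ i b, f (i, b) ∈ (ε i).1 := by
    intro i b
    rw [← hf i]
    cases b <;> simp
  refine ⟨⟨⟨f, ?_⟩, ?_⟩⟩
  · rintro ⟨i, b⟩ ⟨j, b'⟩ ⟨hij, hb⟩
    simp only at hij hb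
    subst hij
    have := hG _ (h1 (ε i).2)
    rw [← hf i, SimpleGraph.mem_edgeSet] at this
    cases b <;> cases b'
    · exact absurd rfl hb
    · exact this.symm
    · exact this
    · exact absurd rfl hb
  · rintro ⟨i, b⟩ ⟨j, b'⟩ heq
    change f (i, b) = f (j, b') at heq
    by_cases hij : i = j
    · subst hij
      cases b <;> cases b'
      · rfl
      · exact absurd heq.symm (hne i)
      · exact absurd heq (hne i)
      · rfl
    · exfalso
      refine h3 _ (ε i).2 _ (ε j).2 (fun e => hij (ε.injective (Subtype.ext e))) _ (hmem i b) ?_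
      rw [heq]
      exact hmem j b'

lemma hasMatch_of_isContained [Fintype V] {G : SimpleGraph V} {h : Finset (Sym2 V)} {m : ℕ}
    (hG : ∀ e ∈ G.edgeSet, e ∈ h) (H : (matchingGraph m).IsContained G) : HasMatch h univ m := by
  classical
  obtain ⟨f, hf⟩ := H
  have hadj : ∀ i, G.Adj (f (i, true)) (f (i, false)) := fun i =>
    f.map_rel (a := (i, true)) (b := (i, false)) ⟨rfl, by simp⟩
  have hmem : ∀ i v, v ∈ s(f (i, true), f (i, false)) → ∃ b, v = f (i, b) := by
    intro i v hv
    rcases Sym2.mem_iff.1 hv with rfl | rfl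
    · exact ⟨_, rfl⟩
    · exact ⟨_, rfl⟩
  have hdisj : ∀ i j v, v ∈ s(f (i, true), f (i, false)) → v ∈ s(f (j, true), f (j, false)) →
      i = j := by
    intro i j v hi hj
    obtain ⟨b, rfl⟩ := hmem i v hi
    obtain ⟨b', hb'⟩ := hmem j _ hj
    exact (Prod.ext_iff.1 (hf hb')).1
  refine ⟨univ.image fun i => s(f (i, true), f (i, false)), ?_, ?_, ?_, ?_⟩
  · intro e he
    obtain ⟨i, -, rfl⟩ := mem_image.1 he
    exact hG _ (hadj i)
  · intro e he
    obtain ⟨i, -, rfl⟩ := mem_image.1 he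
    simpa using (hadj i).ne
  · intro e he e' he' hne v hv hv'
    obtain ⟨i, -, rfl⟩ := mem_image.1 he
    obtain ⟨j, -, rfl⟩ := mem_image.1 he'
    exact hne (by rw [hdisj i j v hv hv'])
  · rw [card_image_of_injective, card_univ, Fintype.card_fin]
    intro i j hij
    exact hdisj i j _ (Sym2.mem_mk_left _ _) (by
      change s(f (i, true), f (i, false)) = s(f (j, true), f (j, false)) at hij
      rw [← hij]; exact Sym2.mem_mk_left _ _)

lemma mem_edgeSet_fromEdgeSet [Fintype V] {h : Finset (Sym2 V)} (hh : h ⊆ pairs univ)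
    (e : Sym2 V) : e ∈ (SimpleGraph.fromEdgeSet (h : Set (Sym2 V))).edgeSet ↔ e ∈ h := by
  induction e with | _ u v
  rw [SimpleGraph.mem_edgeSet, SimpleGraph.fromEdgeSet_adj, mem_coe]
  exact ⟨fun h => h.1, fun h => ⟨h, (mk_mem_pairs.1 (hh h)).2.2⟩⟩

lemma card_le_extremalNumber [Fintype V] {h : Finset (Sym2 V)} {n m : ℕ}
    (hn : Fintype.card V = n) (hh : h ⊆ pairs univ) (H : ¬ HasMatch h univ m) :
    h.card ≤ SimpleGraph.extremalNumber n (matchingGraph m) := by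
  classical
  subst hn
  have hfree : (matchingGraph m).Free (SimpleGraph.fromEdgeSet (h : Set (Sym2 V))) := fun hc =>
    H (hasMatch_of_isContained (fun e he => (mem_edgeSet_fromEdgeSet hh e).1 he) hc)
  refine le_of_eq_of_le ?_ (SimpleGraph.card_edgeFinset_le_extremalNumber hfree)
  congr 1
  ext e
  exact (mem_edgeSet_fromEdgeSet hh e).symm.trans (@Set.mem_toFinset _ _ (_) e).symm

lemma exists_card_eq_extremalNumber (n : ℕ) {m : ℕ} (hm : 1 ≤ m) :
    ∃ h : Finset (Sym2 (Fin n)), h ⊆ pairs univ ∧ ¬ HasMatch h univ m ∧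
      h.card = SimpleGraph.extremalNumber n (matchingGraph m) := by
  have hne : matchingGraph m ≠ ⊥ := by
    intro h
    have : (matchingGraph m).Adj (⟨0, hm⟩, true) (⟨0, hm⟩, false) := ⟨rfl, by simp⟩
    rw [h] at this
    exact this
  obtain ⟨G, _, hG⟩ := SimpleGraph.exists_isExtremal_free (V := Fin n) hne
  refine ⟨G.edgeFinset, ?_, ?_, ?_⟩
  · intro e
    induction e with | _ u v
    rw [SimpleGraph.mem_edgeFinset, SimpleGraph.mem_edgeSet, mk_mem_pairs]
    exact fun h => ⟨mem_univ _, mem_univ _, h.ne⟩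
  · exact fun h => hG.1 (isContained_of_hasMatch (fun e he => SimpleGraph.mem_edgeFinset.1 he) h)
  · rw [SimpleGraph.card_edgeFinset_of_isExtremal_free hG, Fintype.card_fin]

/-- A clique on 2K - 1 vertices has no room for K disjoint edges. -/
lemma clique_le_extremalNumber {n K : ℕ} (hK : 1 ≤ K) (hn : 2 * K ≤ n) :
    ((K : ℤ) - 1) * (2 * K - 1) ≤ SimpleGraph.extremalNumber n (matchingGraph K) := by
  obtain ⟨P, -, hP⟩ := exists_subset_card_eq (s := (univ : Finset (Fin n))) (n := 2 * K - 1)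
    (by rw [card_univ, Fintype.card_fin]; omega)
  have h1 := card_le_extremalNumber (Fintype.card_fin n) (pairs_mono (subset_univ P)) (m := K) (by
    rintro ⟨M, h1, -, h3, h4⟩
    have := two_mul_le_card h3 h1
    omega)
  have h2 := two_mul_card_pairs P
  have h3 : (P.card : ℤ) = 2 * K - 1 := by omega
  rw [h3] at h2
  zify at h1
  linarith

/-- Take all pairs touching a fixed set of K - 1 vertices: disjoint edges use distinct vertices of
that set. -/
lemma star_le_extremalNumber {n K d : ℕ} (hK : 1 ≤ K) (hn : n = 2 * K + d) :
    ((K : ℤ) - 1) * (3 * K + 2 * d) ≤ 2 * SimpleGraph.extremalNumber n (matchingGraph K) := by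
  obtain ⟨S, -, hS⟩ := exists_subset_card_eq (s := (univ : Finset (Fin n))) (n := K - 1)
    (by rw [card_univ, Fintype.card_fin]; omega)
  have h1 := card_le_extremalNumber (h := pairs univ \ pairs (univ \ S)) (Fintype.card_fin n)
    sdiff_subset (m := K) (by
      rintro ⟨M, h1, -, h3, h4⟩
      have := card_le_of_touch h3 (S := S) (by
        intro e he
        have := h1 he
        induction e with | _ u v
        simp only [mem_sdiff, mk_mem_pairs, mem_univ, true_and] at this
        by_cases hu : u ∈ S
        · exact ⟨u, hu, by simp⟩
        · exact ⟨v, by tauto, by simp⟩)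
      omega)
  have h2 := two_mul_card_pairs (univ : Finset (Fin n))
  have h3 := two_mul_card_pairs (univ \ S)
  have h4 := card_sdiff_add_card_eq_card (subset_univ S)
  have h5 := card_sdiff_add_card_eq_card (pairs_mono (subset_univ (univ \ S)))
  rw [card_univ, Fintype.card_fin] at h2 h4
  have h6 : ((univ \ S).card : ℤ) = K + d + 1 := by omega
  have h7 : (n : ℤ) = 2 * K + d := by exact_mod_cast hn
  rw [h6] at h3
  rw [h7] at h2
  zify at h1 h5
  linarith

/-! ### The sufficient condition -/

/-- The sufficient condition for a rainbow matching. -/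
theorem hasRainbowMatching [Fintype V] {L : Type*} {G : SimpleGraph V} {C : G.EdgeLabeling L}
    {K d n : ℕ} (hK : 1 ≤ K) (hd : 2 ≤ d) (hn : 12 ≤ n) (hnK : n = 2 * K + d)
    (hV : Fintype.card V = n)
    (hle : (n.choose 2 : ℤ) + 2 + max (((2 * K).choose 2 : ℤ) - (d.choose 2 : ℤ))
      (SimpleGraph.extremalNumber n (matchingGraph K) : ℤ) ≤
      (G.edgeCount : ℤ) + (SimpleGraph.colorCount C : ℤ)) :
    SimpleGraph.HasRainbowMatching C (K + 1) := by
  classical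
  by_contra hno
  have : Fintype (Set.range C) := (Set.finite_range (ι := G.edgeSet) C).fintype
  set g : Finset (Sym2 V) := G.edgeSet.toFinset with hg
  have hmg : ∀ e, e ∈ g ↔ e ∈ G.edgeSet := fun e => by simp [hg]
  -- One edge is chosen for each color. Then `φ` depends only on the color and fixes the chosen
  -- edges, so injectivity of `φ` follows from injectivity of the coloring on a matching and
  -- conversely.
  let r : Set.range C → G.edgeSet := Set.rangeSplitting C
  have hr : ∀ q, C (r q) = q := Set.apply_rangeSplitting C
  set h : Finset (Sym2 V) := (univ : Finset (Set.range C)).image fun q => (r q).1 with hh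
  let φ : Sym2 V → Sym2 V := fun e => if he : e ∈ G.edgeSet then (r ⟨C ⟨e, he⟩, ⟨e, he⟩, rfl⟩).1 else e
  have hφ : ∀ e (he : e ∈ G.edgeSet), φ e = (r ⟨C ⟨e, he⟩, ⟨e, he⟩, rfl⟩).1 := fun e he => by
    simp only [φ]; rw [dif_pos he]
  have hφC : ∀ e (he : e ∈ G.edgeSet) f (hf : f ∈ G.edgeSet), C ⟨e, he⟩ = C ⟨f, hf⟩ → φ e = φ f := by
    intro e he f hf hef
    rw [hφ e he, hφ f hf]
    congr 2
    exact Subtype.ext hef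
  have hgp : g ⊆ pairs univ := by
    intro e
    induction e with | _ u v
    rw [hmg, SimpleGraph.mem_edgeSet, mk_mem_pairs]
    exact fun h => ⟨mem_univ _, mem_univ _, h.ne⟩
  have hhg : h ⊆ g := by
    intro e he
    obtain ⟨q, -, rfl⟩ := mem_image.1 he
    exact (hmg _).2 (r q).2
  have hhc : h.card = SimpleGraph.colorCount C := by
    rw [hh, card_image_of_injective, card_univ, SimpleGraph.colorCount, ← Nat.card_coe_set_eq,
      Nat.card_eq_fintype_card]
    intro q q' hqq
    have : r q = r q' := Subtype.ext hqq
    exact Subtype.ext (by rw [← hr q, ← hr q', this])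
  have hgc : g.card = G.edgeCount := by
    rw [SimpleGraph.edgeCount, Set.ncard_eq_toFinset_card']
  have hgm : (pairs univ \ g).card + g.card = (pairs (univ : Finset V)).card :=
    card_sdiff_add_card_eq_card hgp
  rw [card_pairs, card_univ, hV] at hgm
  have hex := le_max_right (((2 * K).choose 2 : ℤ) - (d.choose 2 : ℤ))
    (SimpleGraph.extremalNumber n (matchingGraph K) : ℤ)
  have hfst := le_max_left (((2 * K).choose 2 : ℤ) - (d.choose 2 : ℤ))
    (SimpleGraph.extremalNumber n (matchingGraph K) : ℤ)
  set x := max (((2 * K).choose 2 : ℤ) - (d.choose 2 : ℤ))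
    (SimpleGraph.extremalNumber n (matchingGraph K) : ℤ)
  refine Config.false (K := K) (d := d) (x := x) (h := h) (g := g) (φ := φ)
    ⟨hK, hd, by omega, by rw [card_univ, hV, hnK], hhg, hgp, ?_, ?_, ?_, ?_, ?_, ?_, ?_, ?_⟩
  · intro e he
    rw [hφ e ((hmg e).1 he)]
    exact mem_image_of_mem _ (mem_univ _)
  · intro e he
    obtain ⟨q, -, rfl⟩ := mem_image.1 he
    rw [hφ _ (r q).2]
    congr 2
    exact Subtype.ext (hr q)
  · intro M hM hmat hcard hinj
    refine hno ⟨M.subtype (· ∈ G.edgeSet), ?_, ?_, ?_⟩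
    · rw [card_subtype, filter_true_of_mem fun e he => (hmg e).1 (hM he), hcard]
    · intro e he f hf hef v hv
      exact hmat e.1 (mem_subtype.1 he) f.1 (mem_subtype.1 hf) (fun h => hef (Subtype.ext h)) v
        hv.1 hv.2
    · intro e he f hf hef
      apply Subtype.ext
      exact hinj (mem_subtype.1 (mem_coe.1 he)) (mem_subtype.1 (mem_coe.1 hf))
        (hφC e.1 e.2 f.1 f.2 hef)
  · intro h' hh' H
    have := card_le_extremalNumber hV (hh'.trans (hhg.trans hgp)) H
    zify at this
    linarith
  · rw [← hhc, ← hgc] at hle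
    zify at hgm
    linarith
  · exact (clique_le_extremalNumber hK (by omega)).trans hex
  · have := star_le_extremalNumber hK hnK
    linarith
  · have h1 := two_mul_choose_two (2 * K)
    have h2 := two_mul_choose_two d
    push_cast at h1
    linarith

/-! ### Tight examples -/

/-- A coloring in which `h` is rainbow and all remaining edges of `g` share one further color. -/
lemma exists_coloring {n k : ℕ} {h g : Finset (Sym2 (Fin n))} (hhg : h ⊆ g) (hg : g ⊆ pairs univ)
    (hne : ∃ e ∈ g, e ∉ h)
    (hno : ∀ M ⊆ g, IsMatch M → M.card = k → ¬ (M \ h).card ≤ 1) :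
    ∃ (G : SimpleGraph (Fin n)) (C : G.EdgeLabeling ℕ), G.edgeCount = g.card ∧
      SimpleGraph.colorCount C = h.card + 1 ∧ ¬ SimpleGraph.HasRainbowMatching C k := by
  let ε := Fintype.equivFin (Sym2 (Fin n))
  let G : SimpleGraph (Fin n) := SimpleGraph.fromEdgeSet (g : Set (Sym2 (Fin n)))
  have hG : ∀ e, e ∈ G.edgeSet ↔ e ∈ g := mem_edgeSet_fromEdgeSet hg
  let C : G.EdgeLabeling ℕ := fun e => if e.1 ∈ h then (ε e.1).val + 1 else 0
  refine ⟨G, C, ?_, ?_, ?_⟩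
  · rw [SimpleGraph.edgeCount, ← Set.ncard_coe_finset]
    congr 1
    ext e
    rw [hG, mem_coe]
  · have hrange : Set.range C = ((insert 0 (h.image fun e => (ε e).val + 1) : Finset ℕ) : Set ℕ) := by
      ext q
      simp only [coe_insert, coe_image, Set.mem_insert_iff, Set.mem_image, mem_coe]
      constructor
      · rintro ⟨e, rfl⟩
        by_cases he : e.1 ∈ h
        · exact Or.inr ⟨e.1, he, by simp [C, he]⟩
        · exact Or.inl (by simp [C, he])
      · rintro (rfl | ⟨e, he, rfl⟩)
        · obtain ⟨e, he, he'⟩ := hne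
          exact ⟨⟨e, (hG e).2 he⟩, by simp [C, he']⟩
        · exact ⟨⟨e, (hG e).2 (hhg he)⟩, by simp [C, he]⟩
    rw [SimpleGraph.colorCount, hrange, Set.ncard_coe_finset, card_insert_of_notMem (by simp),
      card_image_of_injective]
    intro e e' hee
    exact ε.injective (Fin.ext (Nat.succ_injective hee))
  · rintro ⟨M, h1, h2, h3⟩
    refine hno (M.map (Function.Embedding.subtype _)) ?_ ?_ (by rw [card_map, h1]) ?_
    · intro e he
      obtain ⟨f, -, rfl⟩ := mem_map.1 he
      exact (hG _).1 f.2
    · intro e he e' he' hee v hv hv'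
      obtain ⟨f, hf, rfl⟩ := mem_map.1 he
      obtain ⟨f', hf', rfl⟩ := mem_map.1 he'
      exact h2 f hf f' hf' (fun hh => hee (by rw [hh])) v ⟨hv, hv'⟩
    · rw [card_le_one]
      intro e he e' he'
      obtain ⟨he, heh⟩ := mem_sdiff.1 he
      obtain ⟨he', heh'⟩ := mem_sdiff.1 he'
      obtain ⟨f, hf, rfl⟩ := mem_map.1 he
      obtain ⟨f', hf', rfl⟩ := mem_map.1 he'
      simp only [Function.Embedding.subtype_apply] at heh heh'
      rw [h3 hf hf' (by simp [C, heh, heh'])]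

/-- Tightness for the first term of the maximum. -/
theorem exists_tight_clique {K d n : ℕ} (hK : 1 ≤ K) (hd : 2 ≤ d) (hnK : n = 2 * K + d) :
    ∃ (G : SimpleGraph (Fin n)) (C : G.EdgeLabeling ℕ),
      (G.edgeCount : ℤ) + (SimpleGraph.colorCount C : ℤ) =
        (n.choose 2 : ℤ) + 1 + (((2 * K).choose 2 : ℤ) - (d.choose 2 : ℤ)) ∧
      ¬ SimpleGraph.HasRainbowMatching C (K + 1) := by
  obtain ⟨P, -, hP⟩ := exists_subset_card_eq (s := (univ : Finset (Fin n))) (n := 2 * K)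
    (by rw [card_univ, Fintype.card_fin]; omega)
  have hPc := card_sdiff_add_card_eq_card (subset_univ P)
  rw [card_univ, Fintype.card_fin] at hPc
  obtain ⟨p, hp⟩ := card_pos.1 (show 0 < P.card by omega)
  obtain ⟨q, hq⟩ := card_pos.1 (show 0 < (univ \ P).card by omega)
  have hq := (mem_sdiff.1 hq).2
  have hpq : p ≠ q := fun e => hq (e ▸ hp)
  obtain ⟨G, C, h1, h2, h3⟩ := exists_coloring (k := K + 1) (h := pairs P)
    (g := pairs univ \ pairs (univ \ P)) (by
      intro e
      induction e with | _ u v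
      simp only [mem_sdiff, mk_mem_pairs, mem_univ, true_and]
      tauto) sdiff_subset
    ⟨s(p, q), by simp [hp, hpq], by simp [hq]⟩ (by
      intro M hM hmat hcard hle
      -- K + 1 disjoint edges do not fit inside `P`, so the single edge allowed outside `pairs P` is
      -- used. It takes a vertex of `P`, leaving 2K - 1 vertices for the other K edges.
      obtain ⟨e, he⟩ : (M \ pairs P).Nonempty := by
        rw [sdiff_nonempty]
        intro hsub
        have := two_mul_le_card hmat hsub
        omega
      obtain ⟨v, hvP, hve⟩ : ∃ v ∈ P, v ∈ e := by
        have := hM (mem_sdiff.1 he).1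
        induction e with | _ u v
        simp only [mem_sdiff, mk_mem_pairs, mem_univ, true_and] at this
        by_cases hu : u ∈ P
        · exact ⟨u, hu, by simp⟩
        · exact ⟨v, by tauto, by simp⟩
      have hsub : M.erase e ⊆ pairs (P.erase v) := by
        intro f hf
        obtain ⟨hfe, hfM⟩ := mem_erase.1 hf
        have hfP : f ∈ pairs P := by
          by_contra hfP
          exact hfe (card_le_one.1 hle f (mem_sdiff.2 ⟨hfM, hfP⟩) e he)
        have hv := hmat e (mem_sdiff.1 he).1 f hfM hfe.symm v hve
        induction f with | _ a b
        rw [mk_mem_pairs] at hfP ⊢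
        rw [Sym2.mem_iff, not_or] at hv
        exact ⟨mem_erase.2 ⟨Ne.symm hv.1, hfP.1⟩, mem_erase.2 ⟨Ne.symm hv.2, hfP.2.1⟩, hfP.2.2⟩
      have := two_mul_le_card (hmat.subset (erase_subset e M)) hsub
      rw [card_erase_of_mem (mem_sdiff.1 he).1, card_erase_of_mem hvP] at this
      omega)
  refine ⟨G, C, ?_, h3⟩
  have h4 := card_sdiff_add_card_eq_card (pairs_mono (subset_univ (univ \ P)))
  rw [card_pairs, card_pairs, card_univ, Fintype.card_fin, show (univ \ P).card = d by omega] at h4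
  rw [h1, h2, card_pairs, hP]
  zify at h4
  push_cast
  linarith

/-- Tightness for the second term of the maximum. -/
theorem exists_tight_extremal {K n : ℕ} (hK : 1 ≤ K) (hn : 2 * K ≤ n) :
    ∃ (G : SimpleGraph (Fin n)) (C : G.EdgeLabeling ℕ),
      (G.edgeCount : ℤ) + (SimpleGraph.colorCount C : ℤ) =
        (n.choose 2 : ℤ) + 1 + (SimpleGraph.extremalNumber n (matchingGraph K) : ℤ) ∧
      ¬ SimpleGraph.HasRainbowMatching C (K + 1) := by
  obtain ⟨h, hh, hno, hcard⟩ := exists_card_eq_extremalNumber n hK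
  obtain ⟨P, -, hP⟩ := exists_subset_card_eq (s := (univ : Finset (Fin n))) (n := 2 * K)
    (by rw [card_univ, Fintype.card_fin]; omega)
  -- With G complete, the extra color does occur: otherwise the extremal graph would be complete and
  -- would contain a K-matching on `P`. A rainbow (K + 1)-matching would have K edges in `h`.
  obtain ⟨G, C, h1, h2, h3⟩ := exists_coloring (k := K + 1) hh Subset.rfl (by
      by_contra hcon
      push Not at hcon
      refine hno ((hasMatch_of_card_even (h := h) hP ?_).mono Subset.rfl (subset_univ _) le_rfl)
      rw [sdiff_eq_empty_iff_subset.2 ((pairs_mono (subset_univ P)).trans hcon), card_empty]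
      omega) (by
      intro M hM hmat hMc hle
      have h4 := card_inter_add_card_sdiff M h
      have : HasMatch h univ (M ∩ h).card :=
        ⟨M ∩ h, inter_subset_right, inter_subset_left.trans hM, hmat.subset inter_subset_left, rfl⟩
      exact hno (this.mono Subset.rfl Subset.rfl (by omega)))
  refine ⟨G, C, ?_, h3⟩
  rw [h1, h2, hcard, card_pairs, card_univ, Fintype.card_fin]
  push_cast
  ring

end

end RainbowMatching

theorem theorem1p2 (k n : ℕ) (hk : 2 ≤ k) (hn : 12 ≤ n) (hkn : 2 * k ≤ n) :
    -- the sufficient condition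
    (∀ {V : Type*} [Fintype V] {K : Type*} (G : SimpleGraph V) (C : G.EdgeLabeling K),
      Fintype.card V = n →
      (n.choose 2 : ℤ) + 2 +
          max (((2 * k - 2).choose 2 : ℤ) - ((n - 2 * k + 2).choose 2 : ℤ))
            (SimpleGraph.extremalNumber n (matchingGraph (k - 1)) : ℤ)
        ≤ (G.edgeCount : ℤ) + (SimpleGraph.colorCount C : ℤ) →
      SimpleGraph.HasRainbowMatching C k) ∧
    -- tightness for the first term of the maximum
    (∃ (G : SimpleGraph (Fin n)) (C : G.EdgeLabeling ℕ),
      (G.edgeCount : ℤ) + (SimpleGraph.colorCount C : ℤ) =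
        (n.choose 2 : ℤ) + 1 +
          (((2 * k - 2).choose 2 : ℤ) - ((n - 2 * k + 2).choose 2 : ℤ)) ∧
      ¬ SimpleGraph.HasRainbowMatching C k) ∧
    -- tightness for the second term of the maximum
    (∃ (G : SimpleGraph (Fin n)) (C : G.EdgeLabeling ℕ),
      (G.edgeCount : ℤ) + (SimpleGraph.colorCount C : ℤ) =
        (n.choose 2 : ℤ) + 1 +
          (SimpleGraph.extremalNumber n (matchingGraph (k - 1)) : ℤ) ∧
      ¬ SimpleGraph.HasRainbowMatching C k) := by
  obtain ⟨K, rfl⟩ : ∃ K, k = K + 1 := ⟨k - 1, by omega⟩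
  obtain ⟨d, rfl⟩ : ∃ d, n = 2 * K + d := ⟨n - 2 * K, by omega⟩
  have e1 : 2 * (K + 1) - 2 = 2 * K := by omega
  have e2 : 2 * K + d - 2 * (K + 1) + 2 = d := by omega
  rw [e1, e2, Nat.add_sub_cancel]
  exact ⟨fun G C hV hle => RainbowMatching.hasRainbowMatching (by omega) (by omega) hn rfl hV hle,
    RainbowMatching.exists_tight_clique (by omega) (by omega) rfl,
    RainbowMatching.exists_tight_extremal (by omega) (by omega)⟩
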